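/- Let $d\ge 1$ and $p\in[0,1]$. In the parking model on $\mathbb{Z}^d$, each vertex is, independently of the others, initially occupied by a car with probability $p$ and by a vacant parking spot with probability $1-p$. To each vertex $v$ are attached a simple symmetric random walk $(X^v_n)_{n\ge 0}$ on $\mathbb{Z}^d$ with $X^v_0=v$ and a sequence $(U^v_n)_{n\ge0}$ of i.i.d. uniform $[0,1]$ variables, all of these being independent of each other, over all vertices, and of the initial configuration. At every time $n\ge 1$, every unparked car (started at $v$, say) moves to $X^v_n$; whenever one or more cars move to a spot that is still vacant, the one with the largest $U^v_n$ parks there for ever and the spot is no longer vacant; all other cars remain unparked. Let $\mathbb{P}_p$ be the law of the model, and let $$\tau=\sum_{s=1}^{\infty}\mathbf 1\{\text{a car starts at }0\text{ and is unparked at time }s-1\}\in\{0,1,2,\dots\}\cup\{\infty\}$$ be the parking time of the car starting at the origin. (i) For every $p\in(0,1]$ there exists $C_1=C_1(p,d)>0$ such that $$\mathbb{P}_p(\tau>t)\ \ge\ \exp\!\left(-C_1t^{\frac{d}{d+2}}\right)\qquad\text{for all integers }t\ge 1.$$ (ii) Let $p_0=\tfrac12$ if $d=1$ and $p_0=\tfrac12\left[1-\sqrt{1-(2de)^{-2}}\right]$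 if $d\ge 2$ (so that, for $d\ge2$, $4de\sqrt{p(1-p)}<1$ for $p\in[0,p_0)$, with equality to $1$ at $p=p_0$). Then there is a function $c_2$ of $p\in[0,p_0)$ (depending on $d$) with $c_2(p)>0$ such that, for every $p\in[0,p_0)$, $$\mathbb{P}_p(\tau>t)\ \le\ p\exp\!\left(-c_2(p)\,t^{\frac{d}{d+2}}\right)\qquad\text{for all integers }t\ge 1,$$ and $c_2$ is bounded away from $0$ on every closed subinterval $[a,b]\subset[0,p_0)$. -/

import Mathlib

open MeasureTheory ProbabilityTheory
open scoped ENNReal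

noncomputable section

namespace Parking

/-- The vertices of the lattice `ℤ^d`. -/
abbrev Site (d : ℕ) : Type := Fin d → ℤ

/-- A nearest-neighbour step of `ℤ^d`: `(i, true)` stands for `+eᵢ`, `(i, false)` for `-eᵢ`. -/
abbrev Step (d : ℕ) : Type := Fin d × Bool

/-- The lattice vector of a step. -/
def Step.toSite {d : ℕ} (s : Step d) : Site d :=
  Pi.single s.1 (if s.2 then 1 else -1)

/-- The random data attached to one vertex: whether a car (`true`) or a vacant parking spot
(`false`) is there initially, the successive steps of the walk that a car started at the vertex
follows, and the marks in `[0,1]` that it uses to break ties. -/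
abbrev Data (d : ℕ) : Type := Bool × (ℕ → Step d) × (ℕ → unitInterval)

/-- The sample space of the parking model on `ℤ^d`. -/
abbrev Config (d : ℕ) : Type := Site d → Data d

/-- The law of the data of one vertex. The three components are independent; a car is present
with probability `p`, the steps are independent and uniform among the `2d` unit vectors, and the
marks are independent and uniform on `[0,1]`. -/
def dataLaw (d : ℕ) [NeZero d] (p : unitInterval) : Measure (Data d) :=
  (bernoulliMeasure true false p).prod
    ((Measure.infinitePi fun _ : ℕ => uniformOn (Set.univ : Set (Step d))).prod
      (Measure.infinitePi fun _ : ℕ => (volume : Measure unitInterval)))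

instance (d : ℕ) [NeZero d] (p : unitInterval) : IsProbabilityMeasure (dataLaw d p) := by
  unfold dataLaw; infer_instance

/-- The measure `ℙ_p` of the parking model: the data of distinct vertices are independent. -/
def law (d : ℕ) [NeZero d] (p : unitInterval) : Measure (Config d) :=
  Measure.infinitePi fun _ : Site d => dataLaw d p

instance (d : ℕ) [NeZero d] (p : unitInterval) : IsProbabilityMeasure (law d p) := by
  unfold law; infer_instance

variable {d : ℕ}

/-- The simple random walk path attached to `v`: its position after `n` steps, starting at `v`. -/
def path (ω : Config d) (v : Site d) (n : ℕ) : Site d :=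
  v + ∑ k ∈ Finset.range n, ((ω v).2.1 k).toSite

/-- The tie-breaking mark used at time `n` by the car started at `v`. -/
def mark (ω : Config d) (v : Site d) (n : ℕ) : unitInterval := (ω v).2.2 n

/-- The state of the system at a given time. Cars are named by the vertex they started from. -/
structure State (d : ℕ) where
  /-- the (starting vertices of the) cars that have not parked yet -/
  unparked : Set (Site d)
  /-- the parking spots that are still vacant -/
  vacant : Set (Site d)

/-- In state `S`, the car started at `v` parks at time `n`: it is unparked, it moves at time `n`
to a vacant spot, and its mark of time `n` is the largest one among the unparked cars that
arrive there at time `n`. (Almost surely no two marks coincide, so that exactly one of the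
arriving cars parks.) -/
def ParksAt (ω : Config d) (S : State d) (n : ℕ) (v : Site d) : Prop :=
  v ∈ S.unparked ∧ path ω v n ∈ S.vacant ∧
    ∀ w ∈ S.unparked, path ω w n = path ω v n → mark ω w n ≤ mark ω v n

/-- The state at time `n`, all the unparked cars moving simultaneously at each time step. -/
def state (ω : Config d) : ℕ → State d
  | 0 => ⟨{v | (ω v).1 = true}, {v | (ω v).1 = false}⟩
  | n + 1 =>
    ⟨{v ∈ (state ω n).unparked | ¬ ParksAt ω (state ω n) (n + 1) v},
     {x ∈ (state ω n).vacant |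
       ¬ ∃ v, ParksAt ω (state ω n) (n + 1) v ∧ path ω v (n + 1) = x}⟩

open Classical in
/-- The parking time of the car started at `v`: the number of times `s ≥ 1` such that a car
starts at `v` and is unparked at time `s - 1` (so it is `0` if no car starts at `v`). -/
def parkingTime (v : Site d) (ω : Config d) : ℝ≥0∞ :=
  ∑' s : ℕ, if v ∈ (state ω s).unparked then 1 else 0

/-- The threshold `p₀`: it is `1/2` in dimension one, and in dimension `d ≥ 2` the smaller
solution of `4 d e √(p (1 - p)) = 1`. -/
def p₀ (d : ℕ) : ℝ :=
  if d = 1 then 1 / 2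
  else 1 / 2 * (1 - Real.sqrt (1 - (2 * (d : ℝ) * Real.exp 1) ^ (-2 : ℤ)))

end Parking

end

/-! Lower bound. Put cars on a whole cube of radius `r` around the origin and let the walk of the
origin's car stay there up to time `t`: it never meets a spot. The cost is `p ^ (2r+1)^d` times a
survival probability of order `exp(-C t / r²)`, and the two exponents balance at `r ≈ t^(1/(d+2))`.

Upper bound. If the car of the origin is unparked at time `t`, each spot it visited was filled by
another car, each spot visited by that car was filled earlier, and so on. This gives a finite
connected set `A` that contains the walk and in which every spot is filled by a car of `A` other
than that of the origin, so cars outnumber spots (`exists_linked_of_unparked`). Initial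
configuration and walk are independent, so a union bound over the positions of the cars bounds the
contribution of an `A` with `m` sites by `p · 2^m s^(m-1)`, `s = √(p(1-p))`, times the probability
that the walk survives in `A`.

The sum over `A` is controlled by percolation: the events that `A` is the open cluster of the origin
are disjoint, so `∑ κ^|A| ≤ (1-q)^(-2)` with `κ = q(1-q)^(2d-2)` (`sum_animal_pow_le`). The
definition of `p₀` allows `2s < κ`, leaving a factor `μ^m` with `μ < 1`. A heat kernel estimate
bounds survival by `2 exp(-c t / m^(2/d))` (`exists_survival_le`). For every `m` one of these two
factors is at most of order `exp(-c' t^(d/(d+2)))`. The multiplicative constant is removed by the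
chance of parking at the first step (`law_unparked_one_le`). -/

noncomputable section

namespace Parking

variable {d : ℕ}

/-! ### Connected sets of sites -/

/-- Nearest-neighbour adjacency on `ℤ^d`. -/
def Nbr (x y : Site d) : Prop := ∃ s : Step d, y = x + s.toSite

lemma Step.toSite_flip (s : Step d) : Step.toSite (s.1, !s.2) = -s.toSite := by
  unfold Step.toSite
  rw [← Pi.single_neg]
  cases s.2 <;> simp

lemma Nbr.symm {x y : Site d} (h : Nbr x y) : Nbr y x := by
  obtain ⟨s, rfl⟩ := h
  exact ⟨(s.1, !s.2), by rw [Step.toSite_flip]; simp⟩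

/-- A set of sites is linked if it is connected for the nearest-neighbour adjacency. -/
def Linked (A : Set (Site d)) : Prop :=
  ∀ S : Set (Site d), (A ∩ S).Nonempty → (∀ x ∈ A ∩ S, ∀ y ∈ A, Nbr x y → y ∈ S) → A ⊆ S

lemma linked_singleton (x : Site d) : Linked {x} := by
  rintro S ⟨y, rfl, hy⟩ - z rfl
  exact hy

lemma Linked.union {A B : Set (Site d)} (hA : Linked A) (hB : Linked B)
    (hAB : (A ∩ B).Nonempty) : Linked (A ∪ B) := by
  obtain ⟨z, hzA, hzB⟩ := hAB
  rintro S ⟨x, hx, hxS⟩ hS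
  have key : ∀ {C : Set (Site d)}, Linked C → C ⊆ A ∪ B → (C ∩ S).Nonempty → C ⊆ S :=
    fun hC hsub hne => hC S hne fun x hx y hy h => hS x ⟨hsub hx.1, hx.2⟩ y (hsub hy) h
  rcases hx with hx | hx
  · have h := key hA Set.subset_union_left ⟨x, hx, hxS⟩
    exact Set.union_subset h (key hB Set.subset_union_right ⟨z, hzB, h hzA⟩)
  · have h := key hB Set.subset_union_right ⟨x, hx, hxS⟩
    exact Set.union_subset (key hA Set.subset_union_left ⟨z, hzA, h hzB⟩) h

lemma Linked.insert {A : Set (Site d)} (hA : Linked A) {x y : Site d} (hx : x ∈ A)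
    (hxy : Nbr x y) : Linked (insert y A) := by
  rintro S ⟨z, hz, hzS⟩ hS
  have key : (A ∩ S).Nonempty → A ⊆ S := fun hne =>
    hA S hne fun u hu v hv h => hS u ⟨Or.inr hu.1, hu.2⟩ v (Or.inr hv) h
  rcases hz with rfl | hz
  · have hxS : x ∈ S := hS z ⟨Or.inl rfl, hzS⟩ x (Or.inr hx) hxy.symm
    exact Set.insert_subset hzS (key ⟨x, hx, hxS⟩)
  · have h := key ⟨z, hz, hzS⟩
    exact Set.insert_subset (hS x ⟨Or.inr hx, h hx⟩ y (Or.inl rfl) hxy) h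

/-! ### Deterministic analysis of the dynamics -/

lemma path_zero (ω : Config d) (v : Site d) : path ω v 0 = v := by simp [path]

lemma nbr_path_succ (ω : Config d) (v : Site d) (n : ℕ) :
    Nbr (path ω v n) (path ω v (n + 1)) :=
  ⟨(ω v).2.1 n, by simp [path, Finset.sum_range_succ, add_assoc]⟩

/-- The starting point is recovered from the endpoint and the first `n` steps. Hence finitely many
cars compete for a spot and a largest mark exists, for every `ω` and not only almost surely. -/
lemma finite_setOf_path_eq (ω : Config d) (n : ℕ) (x : Site d) :
    {w | path ω w n = x}.Finite := by
  refine (Set.finite_range fun f : Fin n → Step d => x - ∑ k, (f k).toSite).subset ?_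
  rintro w rfl
  refine ⟨fun k => (ω w).2.1 k, ?_⟩
  simp [path, Finset.sum_range]

/-- The car started at `v` parks at time `n + 1`. -/
def Parks (ω : Config d) (n : ℕ) (v : Site d) : Prop := ParksAt ω (state ω n) (n + 1) v

lemma unparked_antitone (ω : Config d) : Antitone fun n => (state ω n).unparked :=
  antitone_nat_of_succ_le fun _ _ hv => hv.1

lemma vacant_antitone (ω : Config d) : Antitone fun n => (state ω n).vacant :=
  antitone_nat_of_succ_le fun _ _ hv => hv.1

lemma car_of_unparked {ω : Config d} {n : ℕ} {v : Site d} (h : v ∈ (state ω n).unparked) :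
    (ω v).1 = true := unparked_antitone ω (Nat.zero_le n) h

lemma spot_of_vacant {ω : Config d} {n : ℕ} {v : Site d} (h : v ∈ (state ω n).vacant) :
    (ω v).1 = false := vacant_antitone ω (Nat.zero_le n) h

lemma Parks.notMem_unparked {ω : Config d} {n m : ℕ} {v : Site d} (h : Parks ω n v)
    (hnm : n < m) : v ∉ (state ω m).unparked :=
  fun hv => (unparked_antitone ω hnm hv).2 h

lemma Parks.time_unique {ω : Config d} {n m : ℕ} {v : Site d} (hn : Parks ω n v)
    (hm : Parks ω m v) : n = m := by
  rcases lt_trichotomy n m with h | h | h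
  · exact absurd hm.1 (hn.notMem_unparked h)
  · exact h
  · exact absurd hn.1 (hm.notMem_unparked h)

lemma exists_parks {ω : Config d} {n : ℕ} {v : Site d} (hv : v ∈ (state ω n).unparked)
    (hx : path ω v (n + 1) ∈ (state ω n).vacant) :
    ∃ w, Parks ω n w ∧ path ω w (n + 1) = path ω v (n + 1) := by
  have hfin : {w ∈ (state ω n).unparked | path ω w (n + 1) = path ω v (n + 1)}.Finite :=
    (finite_setOf_path_eq ω (n + 1) (path ω v (n + 1))).subset fun w hw => hw.2
  obtain ⟨w, hw, hmax⟩ := hfin.exists_maximalFor (fun w => mark ω w (n + 1)) _ ⟨v, hv, rfl⟩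
  refine ⟨w, ⟨hw.1, hw.2 ▸ hx, fun u hu hup => ?_⟩, hw.2⟩
  by_contra hlt
  exact hlt (hmax (j := u) ⟨hu, hup.trans hw.2⟩ (le_of_not_ge hlt))

lemma exists_parks_of_notMem_vacant {ω : Config d} {n : ℕ} {x : Site d}
    (hx : (ω x).1 = false) (hn : x ∉ (state ω n).vacant) :
    ∃ m < n, ∃ w, Parks ω m w ∧ path ω w (m + 1) = x := by
  induction n with
  | zero => exact absurd hx hn
  | succ n ih =>
    by_cases h : x ∈ (state ω n).vacant
    · have : ∃ w, Parks ω n w ∧ path ω w (n + 1) = x := by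
        by_contra hc
        exact hn ⟨h, hc⟩
      exact ⟨n, n.lt_succ_self, this⟩
    · obtain ⟨m, hm, h⟩ := ih h
      exact ⟨m, hm.trans n.lt_succ_self, h⟩

lemma notMem_vacant_of_unparked {ω : Config d} {n : ℕ} {v : Site d}
    (hv : v ∈ (state ω (n + 1)).unparked) :
    path ω v (n + 1) ∉ (state ω (n + 1)).vacant := by
  rintro ⟨hx, h⟩
  exact h (exists_parks hv.1 hx)

/-- The set of sites that are responsible for a car being still unparked at a given time. -/
lemma exists_history (ω : Config d) (n : ℕ) : ∀ v ∈ (state ω n).unparked,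
    ∃ A : Finset (Site d), Linked (A : Set (Site d)) ∧ v ∈ A ∧ (∀ r ≤ n, path ω v r ∈ A) ∧
      ∀ x ∈ A, (ω x).1 = false → ∃ m < n, ∃ w ∈ A, Parks ω m w ∧ path ω w (m + 1) = x := by
  classical
  induction n using Nat.strong_induction_on with
  | _ n ih =>
  intro v hv
  cases n with
  | zero =>
    refine ⟨{v}, by simpa using linked_singleton v, by simp, ?_, ?_⟩
    · intro r hr
      obtain rfl : r = 0 := by omega
      simp [path_zero]
    · intro x hx hxs
      obtain rfl : x = v := by simpa using hx
      simp [car_of_unparked hv] at hxs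
  | succ n =>
    obtain ⟨A, hA, hvA, hpath, hfill⟩ := ih n n.lt_succ_self v hv.1
    have hL : Linked (insert (path ω v (n + 1)) (A : Set (Site d))) :=
      hA.insert (hpath n le_rfl) (nbr_path_succ ω v n)
    -- If the new site was a spot, it was filled by some `w`. The history of `w` just before it
    -- parked is glued on through this site, which is adjacent to the previous position of `w`.
    by_cases hx : (ω (path ω v (n + 1))).1 = false
    · obtain ⟨m, hm, w, hw, hwx⟩ :=
        exists_parks_of_notMem_vacant hx (notMem_vacant_of_unparked hv)
      obtain ⟨B, hB, hwB, hpathB, hfillB⟩ := ih m hm w hw.1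
      have hL' : Linked (insert (path ω v (n + 1)) (B : Set (Site d))) :=
        hB.insert (hpathB m le_rfl) (hwx ▸ nbr_path_succ ω w m)
      refine ⟨insert (path ω v (n + 1)) A ∪ insert (path ω v (n + 1)) B, ?_, by simp [hvA],
        ?_, ?_⟩
      · push_cast
        exact hL.union hL' ⟨path ω v (n + 1), by simp⟩
      · intro r hr
        rcases Nat.le_succ_iff.1 hr with h | rfl
        · simp [hpath r h]
        · simp
      · intro y hy hys
        by_cases hyx : y = path ω v (n + 1)
        · exact ⟨m, hm, w, by simp [hwB], hw, hyx ▸ hwx⟩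
        · rcases Finset.mem_union.1 hy with hy | hy
          · obtain ⟨q, hq, u, hu, h⟩ := hfill y (Finset.mem_of_mem_insert_of_ne hy hyx) hys
            exact ⟨q, by omega, u, by simp [hu], h⟩
          · obtain ⟨q, hq, u, hu, h⟩ := hfillB y (Finset.mem_of_mem_insert_of_ne hy hyx) hys
            exact ⟨q, by omega, u, by simp [hu], h⟩
    · refine ⟨insert (path ω v (n + 1)) A, by push_cast; exact hL, by simp [hvA], ?_, ?_⟩
      · intro r hr
        rcases Nat.le_succ_iff.1 hr with h | rfl
        · simp [hpath r h]
        · simp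
      · intro y hy hys
        obtain ⟨q, hq, u, hu, h⟩ := hfill y
          (Finset.mem_of_mem_insert_of_ne hy (by rintro rfl; exact hx hys)) hys
        exact ⟨q, by omega, u, by simp [hu], h⟩

/-- If the car started at `v` is unparked at time `n`, then its path up to time `n` stays in a
finite linked set in which the cars outnumber the parking spots. -/
lemma exists_linked_of_unparked {ω : Config d} {n : ℕ} {v : Site d}
    (hv : v ∈ (state ω n).unparked) :
    ∃ A U : Finset (Site d), Linked (A : Set (Site d)) ∧ U ⊆ A ∧ v ∈ U ∧
      (A \ U).card < U.card ∧ (∀ r ≤ n, path ω v r ∈ A) ∧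
      (∀ x ∈ U, (ω x).1 = true) ∧ ∀ x ∈ A \ U, (ω x).1 = false := by
  classical
  obtain ⟨A, hA, hvA, hpath, hfill⟩ := exists_history ω n v hv
  have hvU : v ∈ A.filter fun x => (ω x).1 = true := by simp [hvA, car_of_unparked hv]
  refine ⟨A, A.filter fun x => (ω x).1 = true, hA, Finset.filter_subset _ _, hvU, ?_, hpath,
    fun x hx => (Finset.mem_filter.1 hx).2, fun x hx => ?_⟩
  · choose! m hm w hwA hw hwx using hfill
    have hspot : ∀ x ∈ A \ A.filter fun x => (ω x).1 = true, x ∈ A ∧ (ω x).1 = false := by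
      intro x hx
      simp only [Finset.mem_sdiff, Finset.mem_filter, not_and, Bool.not_eq_true] at hx
      exact ⟨hx.1, hx.2 hx.1⟩
    rw [← Nat.succ_le_iff, ← Finset.card_erase_add_one hvU]
    -- Sending a spot to the car that filled it is injective, since a car parks only once, and it
    -- misses `v`, which is still unparked; hence the strict inequality.
    refine Nat.succ_le_succ (Finset.card_le_card_of_injOn w ?_ ?_)
    · intro x hx
      obtain ⟨hxA, hxs⟩ := hspot x hx
      have hp := hw x hxA hxs
      refine Finset.mem_coe.2 (Finset.mem_erase.2 ⟨?_, Finset.mem_filter.2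
        ⟨hwA x hxA hxs, car_of_unparked hp.1⟩⟩)
      rintro h
      exact (h ▸ hp).notMem_unparked (hm x hxA hxs) hv
    · intro x hx y hy hxy
      obtain ⟨hxA, hxs⟩ := hspot x hx
      obtain ⟨hyA, hys⟩ := hspot y hy
      have h := (hw x hxA hxs).time_unique (hxy ▸ hw y hyA hys)
      rw [← hwx x hxA hxs, ← hwx y hyA hys, hxy, h]
  · simp only [Finset.mem_sdiff, Finset.mem_filter, not_and, Bool.not_eq_true] at hx
    exact hx.2 hx.1

lemma unparked_of_path_mem {ω : Config d} {n : ℕ} {v : Site d} {A : Set (Site d)}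
    (hA : ∀ x ∈ A, (ω x).1 = true) (hpath : ∀ r ≤ n, path ω v r ∈ A) :
    v ∈ (state ω n).unparked := by
  induction n with
  | zero => exact hA v (by simpa [path_zero] using hpath 0 le_rfl)
  | succ n ih =>
    refine ⟨ih fun r hr => hpath r (hr.trans n.le_succ), fun h => ?_⟩
    simpa [spot_of_vacant h.2.1] using hA _ (hpath (n + 1) le_rfl)

/-- The unparked sets decrease, so the indicators are ones followed by zeros. Being unparked at time
`t` gives the `t + 1` ones of times `0, …, t`. -/
lemma lt_parkingTime_iff (ω : Config d) (v : Site d) (t : ℕ) :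
    (t : ℝ≥0∞) < parkingTime v ω ↔ v ∈ (state ω t).unparked := by
  classical
  unfold parkingTime
  constructor
  · contrapose!
    intro h
    rw [tsum_eq_sum (s := Finset.range t)]
    · refine (Finset.sum_le_card_nsmul _ _ 1 fun s _ => ?_).trans (by simp)
      split_ifs <;> simp
    · intro s hs
      rw [if_neg]
      exact fun hv => h (unparked_antitone ω (by simpa using hs) hv)
  · intro h
    refine lt_of_lt_of_le (b := ((t + 1 : ℕ) : ℝ≥0∞)) (by exact_mod_cast t.lt_succ_self) ?_
    refine le_trans (le_of_eq ?_) (ENNReal.sum_le_tsum (Finset.range (t + 1)))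
    rw [Finset.sum_congr rfl fun s hs => if_pos (unparked_antitone ω
      (Nat.lt_succ_iff.1 (Finset.mem_range.1 hs)) h)]
    simp

end Parking

/-! ### Survival of the walk and probabilities of patterns -/

/-- Prepending an independent coordinate to an i.i.d. sequence yields an i.i.d. sequence. -/
lemma MeasureTheory.Measure.infinitePi_map_cons {X : Type*} [MeasurableSpace X] (μ : Measure X)
    [IsProbabilityMeasure μ] :
    (μ.prod (Measure.infinitePi fun _ : ℕ => μ)).map
      (fun q : X × (ℕ → X) => fun n => Nat.casesOn n q.1 q.2) =
      Measure.infinitePi fun _ : ℕ => μ := by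
  classical
  have hmeas : Measurable
      (fun q : X × (ℕ → X) => (fun n => Nat.casesOn n q.1 q.2 : ℕ → X)) := by
    refine measurable_pi_lambda _ fun n => ?_
    cases n with
    | zero => exact measurable_fst
    | succ n => exact (measurable_pi_apply n).comp measurable_snd
  refine Measure.eq_infinitePi _ fun s t ht => ?_
  rw [Measure.map_apply hmeas (MeasurableSet.pi s.countable_toSet fun i _ => ht i)]
  have hpre : (fun q : X × (ℕ → X) => (fun n => Nat.casesOn n q.1 q.2 : ℕ → X)) ⁻¹'
      (s : Set ℕ).pi t = (if 0 ∈ s then t 0 else Set.univ) ×ˢ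
        ((s.preimage Nat.succ Nat.succ_injective.injOn : Finset ℕ) : Set ℕ).pi
          (fun n => t (n + 1)) := by
    ext ⟨a, f⟩
    simp only [Set.mem_preimage, Set.mem_pi, Finset.mem_coe, Set.mem_prod, Finset.mem_preimage]
    constructor
    · intro h
      refine ⟨?_, fun n hn => h (n + 1) hn⟩
      split_ifs with h0
      · exact h 0 h0
      · trivial
    · rintro ⟨h1, h2⟩ n hn
      cases n with
      | zero => simpa [hn] using h1
      | succ n => exact h2 n hn
  rw [hpre, Measure.prod_prod, Measure.infinitePi_pi _ fun i _ => ht (i + 1)]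
  have hprod : ∏ n ∈ s.preimage Nat.succ Nat.succ_injective.injOn, μ (t (n + 1)) =
      ∏ i ∈ s.erase 0, μ (t i) := by
    rw [Finset.prod_preimage' Nat.succ s Nat.succ_injective.injOn fun i => μ (t i)]
    congr 1
    ext i
    cases i <;> simp
  rw [hprod]
  split_ifs with h0
  · exact Finset.mul_prod_erase s (fun i => μ (t i)) h0
  · rw [Finset.erase_eq_of_notMem h0]; simp

namespace Parking

variable {d : ℕ}

/-- The law of the steps of a simple random walk. -/
def stepLaw (d : ℕ) [NeZero d] : Measure (ℕ → Step d) :=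
  Measure.infinitePi fun _ : ℕ => uniformOn (Set.univ : Set (Step d))

instance (d : ℕ) [NeZero d] : IsProbabilityMeasure (stepLaw d) := by
  unfold stepLaw; infer_instance

open Classical in
/-- The probability that a simple random walk started at a site stays in `A` for `n` steps. -/
def survival (A : Set (Site d)) : ℕ → Site d → ℝ
  | 0, x => if x ∈ A then 1 else 0
  | n + 1, x => if x ∈ A then (2 * d : ℝ)⁻¹ * ∑ s : Step d, survival A n (x + s.toSite) else 0

lemma survival_nonneg (A : Set (Site d)) (n : ℕ) (x : Site d) : 0 ≤ survival A n x := by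
  induction n generalizing x with
  | zero => unfold survival; split_ifs <;> norm_num
  | succ n ih =>
    unfold survival
    split_ifs
    · exact mul_nonneg (by positivity) (Finset.sum_nonneg fun s _ => ih _)
    · exact le_rfl

/-- The step sequences for which the walk started at `x` stays in `A` for `n` steps. -/
def stayEvent (A : Set (Site d)) (n : ℕ) (x : Site d) : Set (ℕ → Step d) :=
  {f | ∀ r ≤ n, x + ∑ k ∈ Finset.range r, (f k).toSite ∈ A}

lemma measurableSet_stayEvent (A : Set (Site d)) (n : ℕ) (x : Site d) :
    MeasurableSet (stayEvent A n x) := by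
  have : stayEvent A n x = ⋂ r, ⋂ (_ : r ≤ n),
      (fun f : ℕ → Step d => x + ∑ k ∈ Finset.range r, (f k).toSite) ⁻¹' A := by
    ext f; simp [stayEvent]
  rw [this]
  refine MeasurableSet.iInter fun r => MeasurableSet.iInter fun _ => ?_
  have hs : Measurable (Step.toSite : Step d → Site d) := measurable_of_countable _
  refine Measurable.const_add (Finset.measurable_sum _ fun k _ =>
    hs.comp (measurable_pi_apply k)) x A.to_countable.measurableSet

/-- Markov property at the first step: `infinitePi_map_cons` splits it off, and the rest is the
recursion that defines `survival`. -/
lemma stepLaw_stayEvent [NeZero d] (A : Set (Site d)) (n : ℕ) (x : Site d) :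
    stepLaw d (stayEvent A n x) = ENNReal.ofReal (survival A n x) := by
  induction n generalizing x with
  | zero =>
    unfold survival
    split_ifs with h
    · have : stayEvent A 0 x = Set.univ := by ext f; simp [stayEvent, h]
      simp [this]
    · have : stayEvent A 0 x = ∅ := by ext f; simp [stayEvent, h]
      simp [this]
  | succ n ih =>
    unfold survival
    split_ifs with h
    · have hpre : (fun q : Step d × (ℕ → Step d) =>
          (fun n => Nat.casesOn n q.1 q.2 : ℕ → Step d)) ⁻¹' stayEvent A (n + 1) x =
          {q | q.2 ∈ stayEvent A n (x + q.1.toSite)} := by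
        ext ⟨s, f⟩
        simp only [stayEvent, Set.mem_preimage, Set.mem_ofPred_eq]
        constructor
        · intro hf r hr
          have := hf (r + 1) (by omega)
          rw [Finset.sum_range_succ'] at this
          convert this using 1
          exact (add_right_comm _ _ _).trans (add_assoc _ _ _)
        · intro hf r hr
          cases r with
          | zero => simpa using h
          | succ r =>
            rw [Finset.sum_range_succ']
            convert hf r (by omega) using 1
            exact ((add_right_comm _ _ _).trans (add_assoc _ _ _)).symm
      have hmeas : Measurable (fun q : Step d × (ℕ → Step d) =>
          (fun n => Nat.casesOn n q.1 q.2 : ℕ → Step d)) := by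
        refine measurable_pi_lambda _ fun n => ?_
        cases n with
        | zero => exact measurable_fst
        | succ n => exact (measurable_pi_apply n).comp measurable_snd
      have hms := hmeas (measurableSet_stayEvent A (n + 1) x)
      rw [stepLaw, ← Measure.infinitePi_map_cons,
        Measure.map_apply hmeas (measurableSet_stayEvent A (n + 1) x), Measure.prod_apply hms,
        lintegral_fintype, hpre]
      have : ∀ s : Step d, (Measure.infinitePi fun _ : ℕ => uniformOn (Set.univ : Set (Step d)))
          (Prod.mk s ⁻¹' {q : Step d × (ℕ → Step d) | q.2 ∈ stayEvent A n (x + q.1.toSite)}) =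
          ENNReal.ofReal (survival A n (x + s.toSite)) := fun s => ih (x + s.toSite)
      simp only [this, uniformOn_univ, Measure.count_singleton]
      rw [← Finset.sum_mul, ENNReal.ofReal_mul (by positivity),
        ENNReal.ofReal_sum_of_nonneg fun s _ => survival_nonneg A n _, mul_comm]
      congr 1
      have hd : (0 : ℝ) < 2 * d := by have := NeZero.pos d; positivity
      rw [ENNReal.ofReal_inv_of_pos hd, one_div]
      congr 1
      rw [ENNReal.ofReal_mul (by norm_num)]
      simp [mul_comm]
    · have : stayEvent A (n + 1) x = ∅ := by
        ext f
        simp only [stayEvent, Set.mem_ofPred_eq, Set.mem_empty_iff_false, iff_false]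
        exact fun hf => h (by simpa using hf 0 (Nat.zero_le _))
      simp [this]

/-- The event that all sites of `U` carry cars, those of `V` are spots, and the steps of the car
started at the origin belong to `G`. -/
def patternEvent (U V : Finset (Site d)) (G : Set (ℕ → Step d)) : Set (Config d) :=
  {ω | (∀ x ∈ U, (ω x).1 = true) ∧ (∀ x ∈ V, (ω x).1 = false) ∧ (ω 0).2.1 ∈ G}

lemma dataLaw_prod [NeZero d] (p : unitInterval) (b : Set Bool) (G : Set (ℕ → Step d)) :
    (dataLaw d p).real (b ×ˢ G ×ˢ Set.univ) =
      (bernoulliMeasure true false p).real b * (stepLaw d).real G := by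
  simp only [measureReal_def, dataLaw, Measure.prod_prod, measure_univ, mul_one,
    ENNReal.toReal_mul, stepLaw]

/-- The event is a box over the finite set `U ∪ V`; `0 ∈ U` makes `G` a condition on one of its
coordinates. -/
lemma law_patternEvent [NeZero d] (p : unitInterval) {U V : Finset (Site d)}
    {G : Set (ℕ → Step d)} (hG : MeasurableSet G) (hUV : Disjoint U V) (h0 : 0 ∈ U) :
    MeasurableSet (patternEvent U V G) ∧
    (law d p).real (patternEvent U V G) =
      (p : ℝ) ^ U.card * (1 - (p : ℝ)) ^ V.card * (stepLaw d).real G := by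
  classical
  let T : Site d → Set (Data d) := fun x =>
    (if x ∈ U then {true} else {false} : Set Bool) ×ˢ
      (if x = 0 then G else Set.univ) ×ˢ (Set.univ : Set (ℕ → unitInterval))
  have hT : ∀ x, MeasurableSet (T x) := fun x =>
    (Set.toFinite _).measurableSet.prod
      ((by split_ifs; exacts [hG, MeasurableSet.univ] : MeasurableSet _).prod MeasurableSet.univ)
  have hset : patternEvent U V G = ((U ∪ V : Finset (Site d)) : Set (Site d)).pi T := by
    ext ω
    simp only [patternEvent, Set.mem_ofPred_eq, Set.mem_pi, Finset.mem_coe, Finset.mem_union, T,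
      Set.mem_prod, Set.mem_univ, and_true]
    constructor
    · rintro ⟨h1, h2, h3⟩ x hx
      constructor
      · split_ifs with hxU
        · exact h1 x hxU
        · exact h2 x (hx.resolve_left hxU)
      · split_ifs with hx0
        · rw [hx0]; exact h3
        · trivial
    · intro h
      refine ⟨fun x hx => ?_, fun x hx => ?_, ?_⟩
      · simpa [hx] using (h x (Or.inl hx)).1
      · simpa [Finset.disjoint_right.1 hUV hx] using (h x (Or.inr hx)).1
      · simpa using (h 0 (Or.inl h0)).2
  refine ⟨hset ▸ MeasurableSet.pi (Finset.countable_toSet _) fun x _ => hT x, ?_⟩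
  rw [hset, measureReal_def, law, Measure.infinitePi_pi _ fun x _ => hT x, ENNReal.toReal_prod,
    Finset.prod_union hUV]
  have hV : ∏ x ∈ V, (dataLaw d p (T x)).toReal = (1 - (p : ℝ)) ^ V.card := by
    refine Finset.prod_eq_pow_card fun x hx => ?_
    have hxU := Finset.disjoint_right.1 hUV hx
    have hx0 : x ≠ 0 := by rintro rfl; exact hxU h0
    have := dataLaw_prod p {false} (Set.univ : Set (ℕ → Step d))
    rw [probReal_univ, mul_one, bernoulliMeasure_real_apply _ (measurableSet_singleton _)] at this
    simpa [T, hxU, hx0, measureReal_def] using this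
  have hU : ∏ x ∈ U, (dataLaw d p (T x)).toReal = (p : ℝ) ^ U.card * (stepLaw d).real G := by
    rw [← Finset.mul_prod_erase U _ h0]
    have h1 : ∏ x ∈ U.erase 0, (dataLaw d p (T x)).toReal = (p : ℝ) ^ (U.erase 0).card := by
      refine Finset.prod_eq_pow_card fun x hx => ?_
      have := dataLaw_prod p {true} (Set.univ : Set (ℕ → Step d))
      rw [probReal_univ, mul_one,
        bernoulliMeasure_real_apply _ (measurableSet_singleton _)] at this
      simpa [T, Finset.mem_of_mem_erase hx, Finset.ne_of_mem_erase hx, measureReal_def] using this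
    have h2 : (dataLaw d p (T 0)).toReal = (p : ℝ) * (stepLaw d).real G := by
      have := dataLaw_prod p {true} G
      rw [bernoulliMeasure_real_apply _ (measurableSet_singleton _)] at this
      simpa [T, h0, measureReal_def] using this
    rw [h1, h2, ← Finset.card_erase_add_one h0, pow_succ]
    ring
  rw [hU, hV]
  ring

/-! ### Lattice animals and percolation -/

/-- The nearest neighbours of a site. -/
def nbrs (x : Site d) : Finset (Site d) := Finset.univ.image fun s : Step d => x + s.toSite

lemma mem_nbrs {x y : Site d} : y ∈ nbrs x ↔ Nbr x y := by
  simp only [nbrs, Finset.mem_image, Finset.mem_univ, true_and, Nbr, eq_comm]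

lemma card_nbrs_le (x : Site d) : (nbrs x).card ≤ 2 * d :=
  Finset.card_image_le.trans (by simp [mul_comm])

/-- The outer vertex boundary of a finite set of sites. -/
def boundary (A : Finset (Site d)) : Finset (Site d) := A.biUnion nbrs \ A

lemma mem_boundary {A : Finset (Site d)} {y : Site d} :
    y ∈ boundary A ↔ (∃ x ∈ A, Nbr x y) ∧ y ∉ A := by
  simp [boundary, mem_nbrs]

/-- The site `y` leaves the boundary, and at most its `2d - 1` neighbours other than `x` enter it.
-/
lemma card_boundary_insert {S : Finset (Site d)} {x y : Site d} (hx : x ∈ S) (hy : y ∉ S)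
    (hxy : Nbr x y) : (boundary (insert y S)).card + 2 ≤ (boundary S).card + 2 * d := by
  have hyb : y ∈ boundary S := mem_boundary.2 ⟨⟨x, hx, hxy⟩, hy⟩
  have hxn : x ∈ nbrs y := mem_nbrs.2 hxy.symm
  have hsub : boundary (insert y S) ⊆ (boundary S).erase y ∪ (nbrs y).erase x := by
    intro z hz
    obtain ⟨⟨u, hu, huz⟩, hzS⟩ := mem_boundary.1 hz
    simp only [Finset.mem_insert, not_or] at hzS
    rcases Finset.mem_insert.1 hu with rfl | hu
    · refine Finset.mem_union_right _ (Finset.mem_erase.2 ⟨?_, mem_nbrs.2 huz⟩)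
      rintro rfl
      exact hzS.2 hx
    · exact Finset.mem_union_left _ (Finset.mem_erase.2 ⟨hzS.1, mem_boundary.2 ⟨⟨u, hu, huz⟩, hzS.2⟩⟩)
  have h1 := (Finset.card_le_card hsub).trans (Finset.card_union_le _ _)
  have h2 := Finset.card_erase_add_one hyb
  have h3 := Finset.card_erase_add_one hxn
  have h4 := card_nbrs_le y
  omega

lemma card_boundary_le {A : Finset (Site d)} (hA : Linked (A : Set (Site d))) {o : Site d}
    (ho : o ∈ A) : (boundary A).card + 2 * A.card ≤ 2 * d * A.card + 2 := by
  classical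
  let F := A.powerset.filter fun S =>
    o ∈ S ∧ (boundary S).card + 2 * S.card ≤ 2 * d * S.card + 2
  have hF : {o} ∈ F := by
    refine Finset.mem_filter.2 ⟨by simpa using ho, by simp, ?_⟩
    have h : (boundary {o}).card ≤ 2 * d :=
      (Finset.card_le_card (by simp [boundary])).trans (card_nbrs_le o)
    simpa using h
  -- A largest subset satisfying the bound must be `A`: otherwise linkedness supplies an adjacent
  -- site of `A` to add.
  obtain ⟨S, hS, hmax⟩ := F.exists_max_image Finset.card ⟨_, hF⟩
  obtain ⟨hSA, hoS, hcard⟩ := Finset.mem_filter.1 hS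
  rw [Finset.mem_powerset] at hSA
  suffices h : A ⊆ S by rwa [Finset.Subset.antisymm h hSA]
  refine Finset.coe_subset.1 (hA S ⟨o, ho, hoS⟩ ?_)
  rintro x ⟨-, hxS⟩ y hyA hxy
  by_contra hyS
  have hxS : x ∈ S := hxS
  have hyS : y ∉ S := hyS
  have hins := card_boundary_insert hxS hyS hxy
  have hc := Finset.card_insert_of_notMem hyS
  have hmem : insert y S ∈ F := by
    refine Finset.mem_filter.2 ⟨Finset.mem_powerset.2 (Finset.insert_subset hyA hSA),
      Finset.mem_insert_of_mem hoS, ?_⟩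
    rw [hc, mul_add, mul_add]
    omega
  have := hmax _ hmem
  omega

/-- With cars read as open sites, `law d q` contains site percolation. Each weight is the
probability that `A` is the open cluster of the origin, and these events are disjoint. -/
lemma sum_animal_weight_le [NeZero d] (q : unitInterval) (𝒜 : Finset (Finset (Site d)))
    (h𝒜 : ∀ A ∈ 𝒜, Linked (A : Set (Site d)) ∧ 0 ∈ A) :
    ∑ A ∈ 𝒜, (q : ℝ) ^ A.card * (1 - (q : ℝ)) ^ (boundary A).card ≤ 1 := by
  have hdisj : ∀ A : Finset (Site d), Disjoint A (boundary A) := fun A => Finset.disjoint_sdiff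
  have hlaw : ∀ A ∈ 𝒜, (law d q).real (patternEvent A (boundary A) Set.univ) =
      (q : ℝ) ^ A.card * (1 - (q : ℝ)) ^ (boundary A).card := fun A hA => by
    rw [(law_patternEvent q MeasurableSet.univ (hdisj A) (h𝒜 A hA).2).2, probReal_univ, mul_one]
  have hsub : ∀ A ∈ 𝒜, ∀ B ∈ 𝒜, ∀ ω, ω ∈ patternEvent A (boundary A) Set.univ →
      ω ∈ patternEvent B (boundary B) Set.univ → (B : Set (Site d)) ⊆ A := by
    intro A hA B hB ω hωA hωB
    refine (h𝒜 B hB).1 A ⟨0, (h𝒜 B hB).2, (h𝒜 A hA).2⟩ ?_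
    rintro x ⟨-, hx⟩ y hy hxy
    by_contra hyA
    have h1 := hωA.2.1 y (mem_boundary.2 ⟨⟨x, hx, hxy⟩, hyA⟩)
    simp [hωB.1 y hy] at h1
  rw [← Finset.sum_congr rfl hlaw, ← probReal_univ (μ := law d q)]
  refine sum_measureReal_le_measureReal_univ (fun A hA =>
    (law_patternEvent q MeasurableSet.univ (hdisj A) (h𝒜 A hA).2).1) ?_
  intro A hA B hB hne
  refine Set.disjoint_left.2 fun ω hωA hωB => hne ?_
  exact Finset.Subset.antisymm (Finset.coe_subset.1 (hsub B hB A hA ω hωB hωA))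
    (Finset.coe_subset.1 (hsub A hA B hB ω hωA hωB))

/-- The generating function of lattice animals, bounded by percolation. -/
lemma sum_animal_pow_le [NeZero d] {q : ℝ} (hq0 : 0 < q) (hq1 : q < 1)
    (𝒜 : Finset (Finset (Site d))) (h𝒜 : ∀ A ∈ 𝒜, Linked (A : Set (Site d)) ∧ 0 ∈ A) :
    ∑ A ∈ 𝒜, (q * (1 - q) ^ (2 * d - 2)) ^ A.card ≤ ((1 - q) ^ 2)⁻¹ := by
  have hq : 0 < 1 - q := by linarith
  have h := sum_animal_weight_le ⟨q, hq0.le, hq1.le⟩ 𝒜 h𝒜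
  rw [← one_div, le_div_iff₀ (by positivity), Finset.sum_mul]
  refine (Finset.sum_le_sum fun A hA => ?_).trans h
  have hcard : (boundary A).card ≤ (2 * d - 2) * A.card + 2 := by
    have := card_boundary_le (h𝒜 A hA).1 (h𝒜 A hA).2
    have hd := NeZero.one_le (n := d)
    rw [Nat.sub_mul]
    have : 2 * A.card ≤ 2 * d * A.card := Nat.mul_le_mul_right _ (by omega)
    omega
  rw [mul_pow, ← pow_mul, mul_assoc, ← pow_add]
  exact mul_le_mul_of_nonneg_left (pow_le_pow_of_le_one hq.le (by linarith) hcard) (by positivity)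

/-- Match each factor `1 - p` with a factor `p`, at weight `s²` per pair; each surplus `p` is at
most `s` because `p² ≤ p(1-p)`. -/
lemma pow_mul_one_sub_pow_le {p s : ℝ} (hp : 0 ≤ p) (hp2 : p ≤ 1 / 2) (hs : 0 ≤ s)
    (hps : p * (1 - p) ≤ s ^ 2) {a b : ℕ} (hab : b ≤ a) :
    p ^ a * (1 - p) ^ b ≤ s ^ (a + b) := by
  have h1 : 0 ≤ 1 - p := by linarith
  have hle : p ≤ s := abs_le_of_sq_le_sq' (by nlinarith) hs |>.2
  obtain ⟨c, rfl⟩ := Nat.exists_eq_add_of_le hab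
  calc p ^ (b + c) * (1 - p) ^ b = (p * (1 - p)) ^ b * p ^ c := by rw [mul_pow]; ring
    _ ≤ (s ^ 2) ^ b * s ^ c := by gcongr
    _ = s ^ (b + c + b) := by ring

/-! ### Union bound over explanations -/

/-- The probability that a given finite set can explain that the car at the origin is unparked. -/
lemma law_explain_le [NeZero d] {p : unitInterval} {s : ℝ} (hp2 : (p : ℝ) ≤ 1 / 2) (hs : 0 ≤ s)
    (hps : (p : ℝ) * (1 - p) ≤ s ^ 2) (A : Finset (Site d)) (t : ℕ) :
    law d p (⋃ U ∈ A.powerset.filter fun U => 0 ∈ U ∧ (A \ U).card < U.card,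
      patternEvent U (A \ U) (stayEvent (A : Set (Site d)) t 0)) ≤
      ENNReal.ofReal (p * (2 ^ A.card * s ^ (A.card - 1) * survival (A : Set (Site d)) t 0)) := by
  have hp0 : (0 : ℝ) ≤ p := p.2.1
  refine (measure_biUnion_finset_le _ _).trans ?_
  have hbound : ∀ U ∈ A.powerset.filter fun U => 0 ∈ U ∧ (A \ U).card < U.card,
      law d p (patternEvent U (A \ U) (stayEvent (A : Set (Site d)) t 0)) ≤
        ENNReal.ofReal (p * (s ^ (A.card - 1) * survival (A : Set (Site d)) t 0)) := by
    intro U hU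
    obtain ⟨hUA, h0, hlt⟩ := Finset.mem_filter.1 hU
    rw [Finset.mem_powerset] at hUA
    rw [← ofReal_measureReal, (law_patternEvent p (measurableSet_stayEvent _ t 0)
      Finset.disjoint_sdiff h0).2, measureReal_def, stepLaw_stayEvent,
      ENNReal.toReal_ofReal (survival_nonneg _ _ _)]
    refine ENNReal.ofReal_le_ofReal ?_
    -- The factor `p` of the origin's car is set aside; the strict majority of cars still leaves `a
    -- ≥ |A \ U|`.
    obtain ⟨a, ha⟩ := Nat.exists_eq_succ_of_ne_zero (Finset.card_pos.2 ⟨_, h0⟩).ne'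
    have hcard : A.card - 1 = a + (A \ U).card := by
      have := Finset.card_sdiff_add_card_eq_card hUA
      omega
    rw [ha, hcard, Nat.succ_eq_add_one, pow_succ']
    have h := pow_mul_one_sub_pow_le hp0 hp2 hs hps (a := a) (b := (A \ U).card) (by omega)
    have h' := mul_le_mul_of_nonneg_right h (survival_nonneg (A : Set (Site d)) t 0)
    calc _ = (p : ℝ) * (p ^ a * (1 - p) ^ (A \ U).card * survival (A : Set (Site d)) t 0) := by ring
      _ ≤ _ := mul_le_mul_of_nonneg_left h' hp0
  refine (Finset.sum_le_card_nsmul _ _ _ hbound).trans ?_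
  have hnn : 0 ≤ s ^ (A.card - 1) * survival (A : Set (Site d)) t 0 :=
    mul_nonneg (by positivity) (survival_nonneg _ _ _)
  rw [← ENNReal.ofReal_nsmul]
  refine ENNReal.ofReal_le_ofReal ?_
  have hc : ((A.powerset.filter fun U => 0 ∈ U ∧ (A \ U).card < U.card).card : ℝ) ≤
      2 ^ A.card := by
    exact_mod_cast (Finset.card_filter_le _ _).trans (Finset.card_powerset A).le
  rw [nsmul_eq_mul, mul_left_comm, mul_assoc (2 ^ A.card)]
  exact mul_le_mul_of_nonneg_left (mul_le_mul_of_nonneg_right hc hnn) hp0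

/-- The probability that the car at the origin is unparked at time `t` is controlled by the
survival probabilities in lattice animals. -/
lemma law_unparked_le [NeZero d] {p : unitInterval} {s q E : ℝ} (hp2 : (p : ℝ) ≤ 1 / 2)
    (hs : 0 ≤ s) (hps : (p : ℝ) * (1 - p) ≤ s ^ 2) (hq0 : 0 < q) (hq1 : q < 1) (t : ℕ)
    (hE : ∀ A : Finset (Site d), 0 ∈ A → 2 ^ A.card * s ^ (A.card - 1) * survival (A : Set (Site d)) t 0 ≤
      E * (q * (1 - q) ^ (2 * d - 2)) ^ A.card) :
    (law d p).real {ω | (t : ℝ≥0∞) < parkingTime 0 ω} ≤ p * (E * ((1 - q) ^ 2)⁻¹) := by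
  have hp0 : (0 : ℝ) ≤ p := p.2.1
  have hq : 0 < 1 - q := by linarith
  have hE0 : 0 ≤ E := by
    have h := hE {0} (by simp)
    have hpos : 0 < (q * (1 - q) ^ (2 * d - 2)) ^ ({0} : Finset (Site d)).card := by positivity
    refine nonneg_of_mul_nonneg_left (le_trans ?_ h) hpos
    exact mul_nonneg (by positivity) (survival_nonneg _ _ _)
  let ι := {A : Finset (Site d) // Linked (A : Set (Site d)) ∧ 0 ∈ A}
  let D : ι → Set (Config d) := fun A =>
    ⋃ U ∈ A.1.powerset.filter fun U => 0 ∈ U ∧ (A.1 \ U).card < U.card,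
      patternEvent U (A.1 \ U) (stayEvent (A.1 : Set (Site d)) t 0)
  have hsub : {ω : Config d | (t : ℝ≥0∞) < parkingTime 0 ω} ⊆ ⋃ A, D A := by
    intro ω hω
    obtain ⟨A, U, hA, hUA, h0, hcard, hpath, hU, hV⟩ :=
      exists_linked_of_unparked ((lt_parkingTime_iff ω 0 t).1 hω)
    refine Set.mem_iUnion.2 ⟨⟨A, hA, hUA h0⟩, Set.mem_biUnion (Finset.mem_filter.2
      ⟨Finset.mem_powerset.2 hUA, h0, hcard⟩) ⟨hU, hV, fun r hr => ?_⟩⟩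
    exact hpath r hr
  have hsum : ∑' A, law d p (D A) ≤ ENNReal.ofReal (p * (E * ((1 - q) ^ 2)⁻¹)) := by
    rw [ENNReal.tsum_eq_iSup_sum]
    refine iSup_le fun T => ?_
    have h1 : ∀ A ∈ T, law d p (D A) ≤
        ENNReal.ofReal (p * (E * (q * (1 - q) ^ (2 * d - 2)) ^ A.1.card)) := fun A _ =>
      (law_explain_le hp2 hs hps A.1 t).trans (ENNReal.ofReal_le_ofReal
        (mul_le_mul_of_nonneg_left (hE A.1 A.2.2) hp0))
    refine (Finset.sum_le_sum h1).trans ?_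
    rw [← ENNReal.ofReal_sum_of_nonneg fun A _ => by positivity]
    refine ENNReal.ofReal_le_ofReal ?_
    rw [← Finset.mul_sum, ← Finset.mul_sum]
    have h2 := sum_animal_pow_le (d := d) hq0 hq1 (T.map (Function.Embedding.subtype _)) (by
      intro A hA
      obtain ⟨B, -, rfl⟩ := Finset.mem_map.1 hA
      exact B.2)
    rw [Finset.sum_map] at h2
    exact mul_le_mul_of_nonneg_left (mul_le_mul_of_nonneg_left h2 hE0) hp0
  refine ENNReal.toReal_le_of_le_ofReal (by positivity) ?_
  exact (measure_mono hsub).trans ((measure_iUnion_le _).trans hsum)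

/-! ### Heat kernel bound by Fourier analysis -/

/-- Lebesgue measure on the cube `(-π, π]^d`. -/
def cubeMeasure (d : ℕ) : Measure (Fin d → ℝ) :=
  Measure.pi fun _ => (volume : Measure ℝ).restrict (Set.Ioc (-Real.pi) Real.pi)

instance (d : ℕ) : IsFiniteMeasure (cubeMeasure d) := by
  unfold cubeMeasure; infer_instance

/-- The characteristic function of a step of the simple random walk. -/
def charFn (θ : Fin d → ℝ) : ℝ := (d : ℝ)⁻¹ * ∑ i, Real.cos (θ i)

/-- The heat kernel of the simple random walk, as an inverse Fourier transform. -/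
def heatKernel (n : ℕ) (z : Site d) : ℝ :=
  ((2 * Real.pi) ^ d)⁻¹ *
    ∫ θ, charFn θ ^ n * Real.cos (∑ i, (z i : ℝ) * θ i) ∂cubeMeasure d

/-- Bounding `|cos|` through `sin²` treats `0` and `±π` alike, as the periodicity of the walk
requires. -/
lemma abs_cos_le (x : ℝ) : |Real.cos x| ≤ 1 - Real.sin x ^ 2 / 2 := by
  have h := Real.sin_sq_add_cos_sq x
  refine abs_le_of_sq_le_sq ?_ ?_
  all_goals nlinarith [sq_nonneg (Real.sin x), sq_nonneg (Real.cos x), sq_nonneg (Real.sin x ^ 2)]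

lemma abs_charFn_le [NeZero d] (θ : Fin d → ℝ) :
    |charFn θ| ≤ Real.exp (-(2 * d : ℝ)⁻¹ * ∑ i, Real.sin (θ i) ^ 2) := by
  have hd : (0 : ℝ) < d := by exact_mod_cast NeZero.pos d
  have h1 : |charFn θ| ≤ (d : ℝ)⁻¹ * ∑ i, (1 - Real.sin (θ i) ^ 2 / 2) := by
    unfold charFn
    rw [abs_mul, abs_of_pos (inv_pos.2 hd)]
    gcongr
    exact (Finset.abs_sum_le_sum_abs _ _).trans (Finset.sum_le_sum fun i _ => abs_cos_le _)
  have h2 : (d : ℝ)⁻¹ * ∑ i, (1 - Real.sin (θ i) ^ 2 / 2) =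
      -(2 * d : ℝ)⁻¹ * ∑ i, Real.sin (θ i) ^ 2 + 1 := by
    rw [Finset.sum_sub_distrib, ← Finset.sum_div]
    simp only [Finset.sum_const, Finset.card_univ, Fintype.card_fin, nsmul_eq_mul]
    field_simp
    ring
  exact (h1.trans h2.le).trans (Real.add_one_le_exp _)

lemma abs_charFn_le_one [NeZero d] (θ : Fin d → ℝ) : |charFn θ| ≤ 1 := by
  refine (abs_charFn_le θ).trans (Real.exp_le_one_iff.2 ?_)
  have : 0 ≤ ∑ i, Real.sin (θ i) ^ 2 := Finset.sum_nonneg fun _ _ => sq_nonneg _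
  have h : 0 ≤ (2 * d : ℝ)⁻¹ := by positivity
  nlinarith

lemma continuous_charFn : Continuous (charFn : (Fin d → ℝ) → ℝ) := by
  unfold charFn; fun_prop

lemma integrable_heat [NeZero d] (n : ℕ) (z : Site d) :
    Integrable (fun θ => charFn θ ^ n * Real.cos (∑ i, (z i : ℝ) * θ i)) (cubeMeasure d) := by
  have hc : Continuous fun θ : Fin d → ℝ => charFn θ ^ n * Real.cos (∑ i, (z i : ℝ) * θ i) := by
    have := continuous_charFn (d := d)
    fun_prop
  refine Integrable.of_bound hc.aestronglyMeasurable 1 (Filter.Eventually.of_forall fun θ => ?_)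
  rw [Real.norm_eq_abs, abs_mul, abs_pow]
  exact mul_le_one₀ (pow_le_one₀ (abs_nonneg _) (abs_charFn_le_one θ)) (abs_nonneg _)
    (Real.abs_cos_le_one _)

lemma integral_exp_int_mul (k : ℤ) :
    ∫ x in Set.Ioc (-Real.pi) Real.pi, Complex.exp (k * x * Complex.I) =
      if k = 0 then (2 * Real.pi : ℂ) else 0 := by
  rw [← intervalIntegral.integral_of_le (by linarith [Real.pi_pos])]
  split_ifs with hk
  · subst hk
    simp
    ring
  · have hc : (k * Complex.I : ℂ) ≠ 0 := mul_ne_zero (by exact_mod_cast hk) Complex.I_ne_zero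
    have h := integral_exp_mul_complex (a := -Real.pi) (b := Real.pi) hc
    have he : ∀ x : ℝ, Complex.exp (k * x * Complex.I) = Complex.exp (k * Complex.I * x) :=
      fun x => by ring_nf
    simp only [he, h]
    have : Complex.exp (k * Complex.I * Real.pi) =
        Complex.exp (k * Complex.I * (-Real.pi : ℝ)) := by
      rw [Complex.exp_eq_exp_iff_exists_int]
      exact ⟨k, by push_cast; ring⟩
    rw [this, sub_self, zero_div]

lemma heatKernel_zero (z : Site d) : heatKernel 0 z = if z = 0 then 1 else 0 := by
  have h1 : ∀ θ : Fin d → ℝ, Real.cos (∑ i, (z i : ℝ) * θ i) =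
      (∏ i, Complex.exp ((z i : ℤ) * (θ i : ℝ) * Complex.I)).re := by
    intro θ
    rw [← Complex.exp_sum, ← Finset.sum_mul, ← Complex.exp_ofReal_mul_I_re]
    push_cast
    rfl
  have hint : Integrable (fun θ : Fin d → ℝ =>
      ∏ i, Complex.exp ((z i : ℤ) * (θ i : ℝ) * Complex.I)) (cubeMeasure d) := by
    refine Integrable.of_bound (Continuous.aestronglyMeasurable (by fun_prop)) 1 (Filter.Eventually.of_forall fun θ => ?_)
    rw [norm_prod]
    refine (Finset.prod_eq_one fun i _ => ?_).le
    have := Complex.norm_exp_ofReal_mul_I (z i * θ i)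
    push_cast at this
    exact this
  have h2 : ∫ θ, ∏ i, Complex.exp ((z i : ℤ) * (θ i : ℝ) * Complex.I) ∂cubeMeasure d =
      if z = 0 then (2 * Real.pi : ℂ) ^ d else 0 := by
    unfold cubeMeasure
    rw [integral_fintype_prod_eq_prod (fun i (x : ℝ) => Complex.exp ((z i : ℤ) * x * Complex.I))]
    simp only [integral_exp_int_mul]
    split_ifs with hz
    · simp [hz]
    · obtain ⟨i, hi⟩ := Function.ne_iff.1 hz
      exact Finset.prod_eq_zero (Finset.mem_univ i) (if_neg hi)
  unfold heatKernel
  simp only [pow_zero, one_mul, h1]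
  have h3 := Complex.reCLM.integral_comp_comm hint
  simp only [Complex.reCLM_apply] at h3
  rw [h3, h2]
  split_ifs
  · have : ((2 * Real.pi : ℂ) ^ d).re = (2 * Real.pi) ^ d := by
      rw [← Complex.ofReal_re ((2 * Real.pi) ^ d)]; push_cast; rfl
    rw [this, inv_mul_cancel₀ (by positivity)]
  · simp

lemma sum_step {M : Type*} [AddCommMonoid M] (f : Step d → M) :
    ∑ s, f s = ∑ i, (f (i, true) + f (i, false)) := by
  rw [Fintype.sum_prod_type]
  simp

lemma sum_toSite_mul (s : Step d) (θ : Fin d → ℝ) :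
    ∑ i, ((s.toSite i : ℤ) : ℝ) * θ i = (if s.2 then 1 else -1) * θ s.1 := by
  rw [Finset.sum_eq_single s.1]
  · simp only [Step.toSite, Pi.single_eq_same]
    split_ifs <;> simp
  · intro i _ hi
    simp [Step.toSite, Pi.single_eq_of_ne hi]
  · simp

lemma heatKernel_succ [NeZero d] (n : ℕ) (z : Site d) :
    heatKernel (n + 1) z = (2 * d : ℝ)⁻¹ * ∑ s : Step d, heatKernel n (z - s.toSite) := by
  unfold heatKernel
  rw [← Finset.mul_sum, ← integral_finsetSum _ fun s _ => integrable_heat n _, mul_left_comm]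
  congr 1
  rw [← integral_const_mul]
  refine integral_congr_ae (Filter.Eventually.of_forall fun θ => ?_)
  dsimp only
  have h : ∀ s : Step d, ∑ i, (((z - s.toSite) i : ℤ) : ℝ) * θ i =
      ∑ i, (z i : ℝ) * θ i - (if s.2 then 1 else -1) * θ s.1 := by
    intro s
    rw [← sum_toSite_mul, ← Finset.sum_sub_distrib]
    exact Finset.sum_congr rfl fun i _ => by rw [Pi.sub_apply]; push_cast; ring
  simp only [h]
  rw [sum_step, pow_succ, charFn]
  simp only [if_true, Real.cos_sub, Bool.false_eq_true, if_false, one_mul, neg_one_mul,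
    Real.cos_neg, Real.sin_neg]
  have hs : ∀ c e : ℝ, ∑ i, (c * (e * Real.cos (θ i) + Real.sin (∑ i, (z i : ℝ) * θ i) *
      Real.sin (θ i)) + c * (e * Real.cos (θ i) + Real.sin (∑ i, (z i : ℝ) * θ i) *
      -Real.sin (θ i))) = 2 * c * e * ∑ i, Real.cos (θ i) := by
    intro c e
    rw [Finset.mul_sum]
    exact Finset.sum_congr rfl fun i _ => by ring
  rw [hs]
  have hd : (d : ℝ) ≠ 0 := by exact_mod_cast NeZero.ne d
  field_simp

lemma heatKernel_nonneg [NeZero d] (n : ℕ) (z : Site d) : 0 ≤ heatKernel n z := by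
  induction n generalizing z with
  | zero => rw [heatKernel_zero]; split_ifs <;> norm_num
  | succ n ih =>
    rw [heatKernel_succ]
    exact mul_nonneg (by positivity) (Finset.sum_nonneg fun s _ => ih _)

/-- Forgets the constraint before time `n`. Of the Fourier formula only the initial value, the
recursion and the resulting positivity matter here. -/
lemma survival_le_sum_heatKernel [NeZero d] (A : Finset (Site d)) (n : ℕ) (x : Site d) :
    survival (A : Set (Site d)) n x ≤ ∑ y ∈ A, heatKernel n (y - x) := by
  induction n generalizing x with
  | zero =>
    simp only [survival, heatKernel_zero, sub_eq_zero, Finset.sum_ite_eq', Finset.mem_coe]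
    rfl
  | succ n ih =>
    unfold survival
    split_ifs
    · simp only [heatKernel_succ]
      rw [← Finset.mul_sum, Finset.sum_comm]
      refine mul_le_mul_of_nonneg_left (Finset.sum_le_sum fun s _ => ?_) (by positivity)
      simpa only [sub_sub] using ih (x + s.toSite)
    · exact Finset.sum_nonneg fun y _ => heatKernel_nonneg _ _

/-- Jordan's inequality around the nearest zero of the sine, one of `0`, `π`, `-π`, with one
Gaussian for each. -/
lemma exp_neg_sin_sq_le {a x : ℝ} (ha : 0 ≤ a) (hx : x ∈ Set.Ioc (-Real.pi) Real.pi) :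
    Real.exp (-a * Real.sin x ^ 2) ≤ Real.exp (-(a * (2 / Real.pi) ^ 2) * x ^ 2) +
      Real.exp (-(a * (2 / Real.pi) ^ 2) * (x - Real.pi) ^ 2) +
      Real.exp (-(a * (2 / Real.pi) ^ 2) * (x + Real.pi) ^ 2) := by
  have key : ∀ y : ℝ, |y| ≤ Real.pi / 2 →
      Real.exp (-a * Real.sin y ^ 2) ≤ Real.exp (-(a * (2 / Real.pi) ^ 2) * y ^ 2) := by
    intro y hy
    have h1 := Real.mul_le_sin (abs_nonneg y) hy
    have h2 : (2 / Real.pi * |y|) ^ 2 ≤ Real.sin |y| ^ 2 :=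
      pow_le_pow_left₀ (by positivity) h1 2
    have h3 : Real.sin |y| ^ 2 = Real.sin y ^ 2 := by
      rcases abs_cases y with h | h <;> simp [h.1]
    rw [mul_pow, sq_abs, h3] at h2
    refine Real.exp_le_exp.2 ?_
    nlinarith
  have e1 := Real.exp_pos (-(a * (2 / Real.pi) ^ 2) * x ^ 2)
  have e2 := Real.exp_pos (-(a * (2 / Real.pi) ^ 2) * (x - Real.pi) ^ 2)
  have e3 := Real.exp_pos (-(a * (2 / Real.pi) ^ 2) * (x + Real.pi) ^ 2)
  rcases le_or_gt |x| (Real.pi / 2) with h | h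
  · linarith [key x h]
  · rcases le_or_gt 0 x with h0 | h0
    · rw [abs_of_nonneg h0] at h
      have := key (x - Real.pi) (abs_le.2 ⟨by linarith [hx.2], by linarith [hx.2]⟩)
      rw [Real.sin_sub_pi, neg_sq] at this
      linarith
    · rw [abs_of_neg h0] at h
      have := key (x + Real.pi) (abs_le.2 ⟨by linarith [hx.1], by linarith [hx.1]⟩)
      rw [Real.sin_add_pi, neg_sq] at this
      linarith

lemma integral_exp_neg_sin_sq_le {a : ℝ} (ha : 0 < a) :
    ∫ x in Set.Ioc (-Real.pi) Real.pi, Real.exp (-a * Real.sin x ^ 2) ≤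
      3 * √(Real.pi / (a * (2 / Real.pi) ^ 2)) := by
  have hb : 0 < a * (2 / Real.pi) ^ 2 := by have := Real.pi_pos; positivity
  have hi : ∀ c : ℝ, Integrable fun x : ℝ =>
      Real.exp (-(a * (2 / Real.pi) ^ 2) * (x + c) ^ 2) :=
    fun c => (integrable_exp_neg_mul_sq hb).comp_add_right c
  have hv : ∀ c : ℝ, ∫ x : ℝ, Real.exp (-(a * (2 / Real.pi) ^ 2) * (x + c) ^ 2) =
      √(Real.pi / (a * (2 / Real.pi) ^ 2)) := fun c => by
    rw [integral_add_right_eq_self fun x => Real.exp (-(a * (2 / Real.pi) ^ 2) * x ^ 2),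
      integral_gaussian]
  have hsum : Integrable fun x : ℝ => Real.exp (-(a * (2 / Real.pi) ^ 2) * (x + 0) ^ 2) +
      Real.exp (-(a * (2 / Real.pi) ^ 2) * (x + -Real.pi) ^ 2) +
      Real.exp (-(a * (2 / Real.pi) ^ 2) * (x + Real.pi) ^ 2) :=
    ((hi 0).add (hi _)).add (hi _)
  calc _ ≤ ∫ x in Set.Ioc (-Real.pi) Real.pi,
        (Real.exp (-(a * (2 / Real.pi) ^ 2) * (x + 0) ^ 2) +
        Real.exp (-(a * (2 / Real.pi) ^ 2) * (x + -Real.pi) ^ 2) +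
        Real.exp (-(a * (2 / Real.pi) ^ 2) * (x + Real.pi) ^ 2)) := by
        refine setIntegral_mono_on ?_ hsum.integrableOn measurableSet_Ioc fun x hx => ?_
        · exact (Continuous.integrableOn_Icc (by fun_prop)).mono_set Set.Ioc_subset_Icc_self
        · simpa [sub_eq_add_neg] using exp_neg_sin_sq_le ha.le hx
    _ ≤ ∫ x, (Real.exp (-(a * (2 / Real.pi) ^ 2) * (x + 0) ^ 2) +
        Real.exp (-(a * (2 / Real.pi) ^ 2) * (x + -Real.pi) ^ 2) +
        Real.exp (-(a * (2 / Real.pi) ^ 2) * (x + Real.pi) ^ 2)) :=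
        setIntegral_le_integral hsum (Filter.Eventually.of_forall fun x => by positivity)
    _ = _ := by
        have h1 := integral_add ((hi 0).add (hi (-Real.pi))) (hi Real.pi)
        simp only [Pi.add_apply] at h1
        rw [h1, integral_add (hi 0) (hi _), hv, hv, hv]
        ring

/-- The integrand is dominated by a product over coordinates, whose one-dimensional integrals are of
order `n^(-1/2)`. -/
lemma exists_heatKernel_le (d : ℕ) [NeZero d] :
    ∃ C : ℝ, 0 < C ∧ ∀ n : ℕ, 1 ≤ n → ∀ z : Site d, heatKernel n z ≤ (C / √n) ^ d := by
  have hd : (0 : ℝ) < d := by exact_mod_cast NeZero.pos d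
  have hpi := Real.pi_pos
  refine ⟨(2 * Real.pi)⁻¹ * (3 * √(Real.pi / ((2 * d : ℝ)⁻¹ * (2 / Real.pi) ^ 2))),
    by positivity, fun n hn z => ?_⟩
  have hn' : (0 : ℝ) < n := by exact_mod_cast hn
  have hbound : ∀ θ : Fin d → ℝ, charFn θ ^ n * Real.cos (∑ i, (z i : ℝ) * θ i) ≤
      ∏ i, Real.exp (-(n * (2 * d : ℝ)⁻¹) * Real.sin (θ i) ^ 2) := by
    intro θ
    calc charFn θ ^ n * Real.cos (∑ i, (z i : ℝ) * θ i)
        ≤ |charFn θ ^ n * Real.cos (∑ i, (z i : ℝ) * θ i)| := le_abs_self _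
      _ ≤ |charFn θ| ^ n := by
        rw [abs_mul, abs_pow]
        exact mul_le_of_le_one_right (by positivity) (Real.abs_cos_le_one _)
      _ ≤ Real.exp (-(2 * d : ℝ)⁻¹ * ∑ i, Real.sin (θ i) ^ 2) ^ n :=
        pow_le_pow_left₀ (abs_nonneg _) (abs_charFn_le θ) n
      _ = _ := by
        rw [← Real.exp_nat_mul, ← Real.exp_sum, ← Finset.mul_sum]
        congr 1
        ring
  have hint : Integrable (fun θ : Fin d → ℝ =>
      ∏ i, Real.exp (-(n * (2 * d : ℝ)⁻¹) * Real.sin (θ i) ^ 2)) (cubeMeasure d) := by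
    refine Integrable.of_bound (Continuous.aestronglyMeasurable (by fun_prop)) 1 (Filter.Eventually.of_forall fun θ => ?_)
    rw [norm_prod]
    refine Finset.prod_le_one (fun i _ => norm_nonneg _) fun i _ => ?_
    rw [Real.norm_eq_abs, Real.abs_exp, Real.exp_le_one_iff]
    have : 0 ≤ (n * (2 * d : ℝ)⁻¹) * Real.sin (θ i) ^ 2 := by positivity
    linarith
  have hle := integral_mono (integrable_heat n z) hint hbound
  have hprod : ∫ θ : Fin d → ℝ, ∏ i, Real.exp (-(n * (2 * d : ℝ)⁻¹) * Real.sin (θ i) ^ 2)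
      ∂cubeMeasure d = (∫ x in Set.Ioc (-Real.pi) Real.pi,
        Real.exp (-(n * (2 * d : ℝ)⁻¹) * Real.sin x ^ 2)) ^ d := by
    unfold cubeMeasure
    rw [integral_fintype_prod_eq_prod
      (fun _ (x : ℝ) => Real.exp (-(n * (2 * d : ℝ)⁻¹) * Real.sin x ^ 2))]
    simp
  rw [hprod] at hle
  have hone := integral_exp_neg_sin_sq_le (a := n * (2 * d : ℝ)⁻¹) (by positivity)
  have hsq : √(Real.pi / (n * (2 * d : ℝ)⁻¹ * (2 / Real.pi) ^ 2)) =
      √(Real.pi / ((2 * d : ℝ)⁻¹ * (2 / Real.pi) ^ 2)) / √n := by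
    rw [← Real.sqrt_div (by positivity)]
    congr 1
    field_simp
  rw [hsq] at hone
  have hnn : 0 ≤ ∫ x in Set.Ioc (-Real.pi) Real.pi,
      Real.exp (-(n * (2 * d : ℝ)⁻¹) * Real.sin x ^ 2) :=
    integral_nonneg fun x => (Real.exp_pos _).le
  unfold heatKernel
  calc _ ≤ ((2 * Real.pi) ^ d)⁻¹ *
        (3 * (√(Real.pi / ((2 * d : ℝ)⁻¹ * (2 / Real.pi) ^ 2)) / √n)) ^ d := by
        refine mul_le_mul_of_nonneg_left (hle.trans (pow_le_pow_left₀ hnn hone d)) (by positivity)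
    _ = _ := by
        rw [← inv_pow, ← mul_pow]
        congr 1
        ring

/-! ### Exponential decay of survival in a finite set -/

lemma survival_eq_zero {A : Set (Site d)} {x : Site d} (hx : x ∉ A) (n : ℕ) :
    survival A n x = 0 := by
  cases n <;> simp [survival, hx]

lemma survival_succ_of_mem {A : Set (Site d)} {x : Site d} (hx : x ∈ A) (n : ℕ) :
    survival A (n + 1) x = (2 * d : ℝ)⁻¹ * ∑ s : Step d, survival A n (x + s.toSite) := by
  rw [survival, if_pos hx]

lemma survival_succ_le (A : Set (Site d)) (n : ℕ) (x : Site d) :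
    survival A (n + 1) x ≤ survival A n x := by
  induction n generalizing x with
  | zero =>
    by_cases hx : x ∈ A
    · rw [survival, if_pos hx, survival, if_pos hx]
      have h1 : ∀ y : Site d, survival A 0 y ≤ 1 := fun y => by
        unfold survival; split_ifs <;> norm_num
      have h2 := Finset.sum_le_card_nsmul Finset.univ
        (fun s : Step d => survival A 0 (x + s.toSite)) 1 fun s _ => h1 _
      simp only [Finset.card_univ, Fintype.card_prod, Fintype.card_fin, Fintype.card_bool,
        nsmul_eq_mul, mul_one] at h2
      push_cast at h2
      refine inv_mul_le_one_of_le₀ (by linarith) (by positivity)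
    · rw [survival_eq_zero hx, survival_eq_zero hx]
  | succ n ih =>
    by_cases hx : x ∈ A
    · rw [survival_succ_of_mem hx, survival_succ_of_mem hx]
      exact mul_le_mul_of_nonneg_left (Finset.sum_le_sum fun s _ => ih _) (by positivity)
    · rw [survival_eq_zero hx, survival_eq_zero hx]

lemma survival_le_one (A : Set (Site d)) (n : ℕ) (x : Site d) : survival A n x ≤ 1 :=
  (antitone_nat_of_succ_le (f := fun n => survival A n x) (fun n => survival_succ_le A n x)
    (Nat.zero_le n)).trans (by simp only [survival]; split_ifs <;> norm_num)

lemma survival_add_le {A : Set (Site d)} {m : ℕ} {r : ℝ} (hr : ∀ x, survival A m x ≤ r)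
    (n : ℕ) (x : Site d) : survival A (n + m) x ≤ r * survival A n x := by
  induction n generalizing x with
  | zero =>
    by_cases hx : x ∈ A
    · simpa [survival, hx] using hr x
    · simp [survival_eq_zero hx]
  | succ n ih =>
    by_cases hx : x ∈ A
    · rw [add_right_comm, survival_succ_of_mem hx, survival_succ_of_mem hx, mul_left_comm, Finset.mul_sum Finset.univ _ r]
      exact mul_le_mul_of_nonneg_left (Finset.sum_le_sum fun s _ => ih _) (by positivity)
    · simp [survival_eq_zero hx]

lemma survival_mul_le {A : Set (Site d)} {m : ℕ} {r : ℝ} (hr0 : 0 ≤ r)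
    (hr : ∀ x, survival A m x ≤ r) (k : ℕ) (x : Site d) : survival A (k * m) x ≤ r ^ k := by
  induction k generalizing x with
  | zero => simpa using survival_le_one A 0 x
  | succ k ih =>
    rw [add_mul, one_mul, pow_succ']
    exact (survival_add_le hr (k * m) x).trans (mul_le_mul_of_nonneg_left (ih x) hr0)

/-- A simple random walk leaves a set of `m` sites after a time of order `m ^ (2 / d)`. -/
lemma exists_survival_le (d : ℕ) [NeZero d] :
    ∃ c : ℝ, 0 < c ∧ ∀ (A : Finset (Site d)) (t : ℕ) (x : Site d), A.Nonempty →
      survival (A : Set (Site d)) t x ≤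
        2 * Real.exp (-c * (t / (A.card : ℝ) ^ (2 / (d : ℝ)))) := by
  obtain ⟨C, hC, hheat⟩ := exists_heatKernel_le d
  have hd : (0 : ℝ) < d := by exact_mod_cast NeZero.pos d
  set K : ℝ := (2 : ℝ) ^ (2 / (d : ℝ)) * C ^ 2 + 1 with hK
  have hKpos : 0 < K := by positivity
  refine ⟨Real.log 2 / K, by positivity, fun A t x hA => ?_⟩
  have hm1 : (1 : ℝ) ≤ A.card := by exact_mod_cast hA.card_pos
  have hM1 : 1 ≤ (A.card : ℝ) ^ (2 / (d : ℝ)) := Real.one_le_rpow hm1 (by positivity)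
  set M := (A.card : ℝ) ^ (2 / (d : ℝ)) with hM
  -- Solves `|A| (C / √B)^d = 1/2`: after `n ≥ B` steps the heat kernel bound leaves survival at
  -- most `1/2`.
  set B := (2 : ℝ) ^ (2 / (d : ℝ)) * C ^ 2 * M with hB
  have hBpos : 0 < B := by positivity
  obtain ⟨n, hn, hnB, hnK⟩ : ∃ n : ℕ, 1 ≤ n ∧ B ≤ n ∧ (n : ℝ) ≤ K * M := by
    refine ⟨⌈B⌉₊, Nat.one_le_ceil_iff.2 hBpos, Nat.le_ceil _, ?_⟩
    have := Nat.ceil_lt_add_one hBpos.le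
    rw [hK, add_mul, ← hB]
    linarith
  have hn0 : (0 : ℝ) < n := by exact_mod_cast hn
  have hhalf : ∀ y, survival (A : Set (Site d)) n y ≤ 1 / 2 := by
    intro y
    have h1 : survival (A : Set (Site d)) n y ≤ A.card * (C / √n) ^ d := by
      refine (survival_le_sum_heatKernel A n y).trans ?_
      rw [← nsmul_eq_mul]
      exact Finset.sum_le_card_nsmul _ _ _ fun z _ => hheat n hn _
    refine h1.trans ?_
    have h2 : (C / √n) ^ 2 ≤ ((2 * A.card : ℝ) ^ (2 / (d : ℝ)))⁻¹ := by
      rw [div_pow, Real.sq_sqrt hn0.le, Real.mul_rpow (by norm_num) (by positivity), ← hM,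
        div_le_iff₀ hn0, inv_mul_eq_div, le_div_iff₀ (by positivity)]
      linarith [hnB, hB]
    have h3 : (C / √n) ^ d ≤ (2 * A.card : ℝ)⁻¹ := by
      have h4 := Real.rpow_le_rpow (by positivity) h2 (show (0 : ℝ) ≤ d / 2 by positivity)
      rw [← Real.rpow_natCast, ← Real.rpow_mul (by positivity), Real.inv_rpow (by positivity),
        ← Real.rpow_mul (by positivity)] at h4
      have e1 : ((2 : ℕ) : ℝ) * (d / 2) = d := by push_cast; ring
      have e2 : 2 / (d : ℝ) * (d / 2) = 1 := by field_simp
      rwa [e1, e2, Real.rpow_one, Real.rpow_natCast] at h4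
    calc (A.card : ℝ) * (C / √n) ^ d ≤ A.card * (2 * A.card : ℝ)⁻¹ := by gcongr
      _ = 1 / 2 := by field_simp
  have h1 : survival (A : Set (Site d)) t x ≤ (1 / 2) ^ (t / n) :=
    (antitone_nat_of_succ_le (f := fun n => survival (A : Set (Site d)) n x)
      (fun n => survival_succ_le _ n x) (Nat.div_mul_le_self t n)).trans
      (survival_mul_le (by norm_num) hhalf _ _)
  refine h1.trans ?_
  -- Rounding down to whole blocks of length `n` loses at most one block, hence the prefactor `2`.
  have h2 : (t : ℝ) / (K * M) ≤ (t / n : ℕ) + 1 := by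
    refine (div_le_div_of_nonneg_left (by positivity) hn0 hnK).trans ?_
    have := Nat.lt_div_mul_add hn (a := t)
    rw [div_le_iff₀ hn0]
    have : (t : ℝ) ≤ (t / n : ℕ) * n + n := by exact_mod_cast this.le
    linarith
  have hexp : ((1 / 2 : ℝ)) ^ (t / n) = Real.exp (-Real.log 2 * (t / n : ℕ)) := by
    rw [mul_comm, Real.exp_nat_mul, Real.exp_neg, Real.exp_log (by norm_num), one_div]
  have h2' : (2 : ℝ) = Real.exp (Real.log 2) := (Real.exp_log (by norm_num)).symm
  rw [hexp]
  nth_rw 2 [h2']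
  rw [← Real.exp_add, Real.exp_le_exp]
  have hl : 0 < Real.log 2 := Real.log_pos (by norm_num)
  have h3 := mul_le_mul_of_nonneg_left h2 hl.le
  have e : -(Real.log 2 / K) * (t / M) = -(Real.log 2 * (t / (K * M))) := by
    field_simp
  rw [e]
  linarith

/-! ### Lower bound: a cube full of cars -/

/-- The cube of radius `r` centred at the origin. -/
def cube (d r : ℕ) : Finset (Site d) := Fintype.piFinset fun _ => Finset.Icc (-(r : ℤ)) r

lemma mem_cube {r : ℕ} {x : Site d} : x ∈ cube d r ↔ ∀ i, -(r : ℤ) ≤ x i ∧ x i ≤ r := by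
  simp [cube]

lemma card_cube (d r : ℕ) : (cube d r).card = (2 * r + 1) ^ d := by
  simp only [cube, Fintype.card_piFinset, Int.card_Icc, Finset.prod_const, Finset.card_univ,
    Fintype.card_fin]
  congr 1
  omega

/-- A product of cosines, an eigenfunction of the simple random walk. -/
def cosProd (θ : ℝ) (x : Site d) : ℝ := ∏ i, Real.cos (θ * x i)

lemma sum_cosProd (θ : ℝ) (x : Site d) :
    ∑ s : Step d, cosProd θ (x + s.toSite) = 2 * d * Real.cos θ * cosProd θ x := by
  have h : ∀ s : Step d, cosProd θ (x + s.toSite) =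
      Real.cos (θ * x s.1 + θ * if s.2 then 1 else -1) *
        ∏ j ∈ Finset.univ.erase s.1, Real.cos (θ * x j) := by
    intro s
    rw [cosProd, ← Finset.mul_prod_erase _ _ (Finset.mem_univ s.1)]
    congr 1
    · congr 1
      simp only [Pi.add_apply, Step.toSite, Pi.single_eq_same]
      split_ifs <;> push_cast <;> ring
    · refine Finset.prod_congr rfl fun j hj => ?_
      simp [Step.toSite, Pi.single_eq_of_ne (Finset.ne_of_mem_erase hj)]
  rw [sum_step]
  have h2 : ∀ i, cosProd θ (x + Step.toSite (i, true)) + cosProd θ (x + Step.toSite (i, false)) =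
      2 * Real.cos θ * cosProd θ x := by
    intro i
    rw [h, h, cosProd, ← Finset.mul_prod_erase _ _ (Finset.mem_univ i)]
    simp only [if_true, Bool.false_eq_true, if_false, mul_one, mul_neg, Real.cos_add,
      Real.cos_neg, Real.sin_neg]
    ring
  simp only [h2, Finset.sum_const, Finset.card_univ, Fintype.card_fin, nsmul_eq_mul]
  ring

/-- The frequency is chosen so that the eigenfunction `cosProd` vanishes where a coordinate is `±(r
+ 1)`, that is, wherever one step can leave the cube. It is at most `1` at time `0`, and the
recursion preserves the comparison. -/
lemma cos_pow_mul_le_survival (hd : d ≠ 0) (r n : ℕ) (x : Site d) (hx : x ∈ cube d r) :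
    Real.cos (Real.pi / (2 * (r + 1))) ^ n * cosProd (Real.pi / (2 * (r + 1))) x ≤
      survival (cube d r : Set (Site d)) n x := by
  set θ := Real.pi / (2 * ((r : ℝ) + 1)) with hθ
  have hr : (0 : ℝ) < r + 1 := by positivity
  have hθr : θ * (r + 1) = Real.pi / 2 := by rw [hθ]; field_simp
  have hθpos : 0 < θ := by have := Real.pi_pos; positivity
  have hcos0 : 0 ≤ Real.cos θ := Real.cos_nonneg_of_mem_Icc ⟨by linarith [Real.pi_pos], by
    rw [← hθr]; nlinarith [(Nat.cast_nonneg r : (0 : ℝ) ≤ r)]⟩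
  induction n generalizing x with
  | zero =>
    rw [survival, if_pos (Finset.mem_coe.2 hx), pow_zero, one_mul]
    exact (le_abs_self _).trans (by
      rw [cosProd, Finset.abs_prod]
      exact Finset.prod_le_one (fun i _ => abs_nonneg _) fun i _ => Real.abs_cos_le_one _)
  | succ n ih =>
    rw [survival_succ_of_mem hx]
    have hstep : ∀ s : Step d, Real.cos θ ^ n * cosProd θ (x + s.toSite) ≤
        survival (cube d r : Set (Site d)) n (x + s.toSite) := by
      intro s
      by_cases hs : x + s.toSite ∈ cube d r
      · exact ih _ hs
      · have hzero : cosProd θ (x + s.toSite) = 0 := by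
          have hj : ∀ j, j ≠ s.1 → (x + s.toSite) j = x j := fun j hj => by
            simp [Step.toSite, Pi.single_eq_of_ne hj]
          have hs1 : (x + s.toSite) s.1 = r + 1 ∨ (x + s.toSite) s.1 = -(r + 1) := by
            by_contra hc
            push Not at hc
            refine hs (mem_cube.2 fun j => ?_)
            have hxj := mem_cube.1 hx j
            rcases eq_or_ne j s.1 with rfl | hne
            · have hval : (x + s.toSite) s.1 = x s.1 + if s.2 then 1 else -1 := by
                simp [Step.toSite]
              rw [hval] at hc ⊢
              split_ifs at hc ⊢ <;> omega
            · rw [hj j hne]; exact hxj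
          refine Finset.prod_eq_zero (Finset.mem_univ s.1) ?_
          rcases hs1 with h | h <;> rw [h] <;> push_cast
          · rw [hθr, Real.cos_pi_div_two]
          · rw [mul_neg, Real.cos_neg, hθr, Real.cos_pi_div_two]
        rw [hzero, mul_zero]
        exact survival_nonneg _ _ _
    refine le_trans (le_of_eq ?_) (mul_le_mul_of_nonneg_left
      (Finset.sum_le_sum fun s _ => hstep s) (by positivity))
    rw [← Finset.mul_sum, sum_cosProd]
    have hd' : (d : ℝ) ≠ 0 := by exact_mod_cast hd
    field_simp
    ring

lemma law_unparked_ge [NeZero d] (p : unitInterval) (r t : ℕ) :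
    (p : ℝ) ^ (2 * r + 1) ^ d * Real.cos (Real.pi / (2 * (r + 1))) ^ t ≤
      (law d p).real {ω | (t : ℝ≥0∞) < parkingTime 0 ω} := by
  have h0 : (0 : Site d) ∈ cube d r := mem_cube.2 fun i => by simp
  have hlaw := (law_patternEvent p (V := ∅)
    (measurableSet_stayEvent (cube d r : Set (Site d)) t 0) (Finset.disjoint_empty_right _) h0).2
  have hsub : patternEvent (cube d r) ∅ (stayEvent (cube d r : Set (Site d)) t 0) ⊆
      {ω | (t : ℝ≥0∞) < parkingTime 0 ω} := fun ω hω =>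
    (lt_parkingTime_iff ω 0 t).2 (unparked_of_path_mem (A := cube d r)
      (fun x hx => hω.1 x hx) hω.2.2)
  refine le_trans ?_ (measureReal_mono hsub)
  rw [hlaw, measureReal_def, stepLaw_stayEvent, ENNReal.toReal_ofReal (survival_nonneg _ _ _),
    card_cube, Finset.card_empty, pow_zero, mul_one]
  refine mul_le_mul_of_nonneg_left ?_ (pow_nonneg p.2.1 _)
  simpa [cosProd] using cos_pow_mul_le_survival (NeZero.ne d) r t 0 h0

lemma exp_neg_sq_le_cos {x : ℝ} (hx : x ^ 2 ≤ 1) : Real.exp (-x ^ 2) ≤ Real.cos x := by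
  refine le_trans ?_ (Real.one_sub_sq_div_two_le_cos (x := x))
  have h1 := Real.add_one_le_exp (x ^ 2)
  rw [Real.exp_neg]
  refine (inv_anti₀ (by positivity) h1).trans ?_
  rw [inv_le_iff_one_le_mul₀ (by positivity)]
  nlinarith [sq_nonneg x]

/-- The stretched exponential lower bound on the tail of the parking time. -/
lemma exists_lower_bound (d : ℕ) [NeZero d] (p : unitInterval) (hp : 0 < p) :
    ∃ C₁ : ℝ, 0 < C₁ ∧ ∀ t : ℕ, 1 ≤ t →
      Real.exp (-C₁ * (t : ℝ) ^ ((d : ℝ) / ((d : ℝ) + 2))) ≤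
        (law d p).real {ω | (t : ℝ≥0∞) < parkingTime 0 ω} := by
  have hp0 : (0 : ℝ) < p := hp
  have hL : 0 ≤ -Real.log p := neg_nonneg.2 (Real.log_nonpos hp0.le p.2.2)
  -- The `5` comes from `2r + 1 ≤ 2R + 3 ≤ 5R`, the `4` from `(θR)² ≤ 4`, where `R = t^(1/(d+2))`
  -- equates `R^d` and `t / R²`.
  refine ⟨5 ^ d * (-Real.log p) + 4, by positivity, fun t ht => ?_⟩
  have ht1 : (1 : ℝ) ≤ t := by exact_mod_cast ht
  have ht0 : (0 : ℝ) < t := by linarith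
  have hd2 : (0 : ℝ) < (d : ℝ) + 2 := by positivity
  set R := (t : ℝ) ^ (1 / ((d : ℝ) + 2)) with hR
  have hR1 : 1 ≤ R := Real.one_le_rpow ht1 (by positivity)
  have hRd : R ^ d = (t : ℝ) ^ ((d : ℝ) / (d + 2)) := by
    rw [hR, ← Real.rpow_natCast, ← Real.rpow_mul ht0.le]
    congr 1
    ring
  have hRt : (t : ℝ) = (t : ℝ) ^ ((d : ℝ) / (d + 2)) * R ^ 2 := by
    rw [hR, ← Real.rpow_natCast, ← Real.rpow_mul ht0.le, ← Real.rpow_add ht0]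
    have : (d : ℝ) / (d + 2) + 1 / (d + 2) * ((2 : ℕ) : ℝ) = 1 := by push_cast; field_simp
    rw [this, Real.rpow_one]
  refine le_trans ?_ (law_unparked_ge p ⌈R⌉₊ t)
  have hr1 : R ≤ (⌈R⌉₊ : ℝ) := Nat.le_ceil R
  have hr2 : (⌈R⌉₊ : ℝ) < R + 1 := Nat.ceil_lt_add_one (by linarith)
  set r := ⌈R⌉₊
  set θ := Real.pi / (2 * ((r : ℝ) + 1)) with hθ
  have hθ0 : 0 < θ := by have := Real.pi_pos; positivity
  have hθR : θ * R ≤ 2 := by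
    rw [hθ, div_mul_eq_mul_div, div_le_iff₀ (by positivity)]
    nlinarith [Real.pi_lt_four, Real.pi_pos]
  have hθ1 : θ ≤ 1 := by
    rw [hθ, div_le_one (by positivity)]
    linarith [Real.pi_lt_four]
  have hsq : (θ * R) ^ 2 ≤ 4 := by nlinarith [mul_pos hθ0 (by linarith : (0 : ℝ) < R)]
  have hcos : Real.exp (-4 * (t : ℝ) ^ ((d : ℝ) / (d + 2))) ≤ Real.cos θ ^ t := by
    calc Real.exp (-4 * (t : ℝ) ^ ((d : ℝ) / (d + 2))) ≤ Real.exp (t * -θ ^ 2) := by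
          rw [Real.exp_le_exp]
          have h : (t : ℝ) * θ ^ 2 = (t : ℝ) ^ ((d : ℝ) / (d + 2)) * (θ * R) ^ 2 := by
            nth_rewrite 1 [hRt]; ring
          have h2 : 0 ≤ (t : ℝ) ^ ((d : ℝ) / (d + 2)) := by positivity
          nlinarith
      _ = Real.exp (-θ ^ 2) ^ t := Real.exp_nat_mul _ _
      _ ≤ Real.cos θ ^ t :=
        pow_le_pow_left₀ (Real.exp_pos _).le (exp_neg_sq_le_cos (by nlinarith)) t
  have hpow : Real.exp (-(5 ^ d * (-Real.log p)) * (t : ℝ) ^ ((d : ℝ) / (d + 2))) ≤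
      (p : ℝ) ^ (2 * r + 1) ^ d := by
    have hk : (((2 * r + 1) ^ d : ℕ) : ℝ) ≤ 5 ^ d * (t : ℝ) ^ ((d : ℝ) / (d + 2)) := by
      rw [← hRd, ← mul_pow]
      push_cast
      exact pow_le_pow_left₀ (by positivity) (by linarith) d
    rw [← Real.exp_log hp0, ← Real.exp_nat_mul, Real.exp_log hp0, Real.exp_le_exp]
    have := mul_le_mul_of_nonneg_left hk hL
    linarith
  refine le_trans (le_of_eq ?_) (mul_le_mul hpow hcos (Real.exp_pos _).le (by positivity))
  rw [← Real.exp_add]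
  congr 1
  ring

/-! ### Upper bound: first step, threshold and assembly -/

/-- The car at the origin has a chance of parking at its first step. -/
lemma law_unparked_one_le [NeZero d] {p : unitInterval} (hp2 : (p : ℝ) ≤ 1 / 2) {t : ℕ}
    (ht : 1 ≤ t) : (law d p).real {ω | (t : ℝ≥0∞) < parkingTime 0 ω} ≤
      p * (1 - (1 / 2) ^ (2 * d) * (2 * d : ℝ)⁻¹) := by
  have hp0 : (0 : ℝ) ≤ p := p.2.1
  let s : Step d := (0, true)
  have hs0 : s.toSite ≠ 0 := fun h => by simpa [s, Step.toSite] using congrFun h 0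
  -- The target of the step and its other neighbours are all spots, so no other car can arrive there
  -- at time `1`.
  let V : Finset (Site d) := insert s.toSite ((nbrs s.toSite).erase 0)
  have h0n : (0 : Site d) ∈ nbrs s.toSite := mem_nbrs.2 (Nbr.symm ⟨s, by simp⟩)
  have h0V : (0 : Site d) ∉ V := by simp [V, hs0.symm]
  have hVcard : V.card ≤ 2 * d := by
    have h1 : V.card ≤ _ := Finset.card_insert_le s.toSite ((nbrs s.toSite).erase 0)
    have h2 := Finset.card_erase_add_one h0n
    have h3 := card_nbrs_le s.toSite
    omega
  let G : Set (ℕ → Step d) := {f | f 0 = s}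
  have hGm : MeasurableSet G := (measurable_pi_apply (X := fun _ : ℕ => Step d) 0)
    (measurableSet_singleton s)
  have hG : (stepLaw d).real G = (2 * d : ℝ)⁻¹ := by
    have h := (measurePreserving_eval_infinitePi
      (fun _ : ℕ => uniformOn (Set.univ : Set (Step d))) 0).measure_preimage
        (measurableSet_singleton s).nullMeasurableSet
    have h' : stepLaw d G = uniformOn (Set.univ : Set (Step d)) {s} := h
    rw [measureReal_def, h', uniformOn_univ]
    simp [mul_comm]
  have hgood := law_patternEvent p (U := {0}) (V := V) hGm (by simpa using h0V) (by simp)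
  have hcar := law_patternEvent (d := d) p (U := {0}) (V := ∅) MeasurableSet.univ (by simp) (by simp)
  have hsub : {ω : Config d | (t : ℝ≥0∞) < parkingTime 0 ω} ⊆
      patternEvent {0} ∅ Set.univ \ patternEvent {0} V G := by
    intro ω hω
    have hun := unparked_antitone ω ht ((lt_parkingTime_iff ω 0 t).1 hω)
    refine ⟨⟨by simpa using car_of_unparked hun, by simp, trivial⟩, fun hg => ?_⟩
    have hpath : path ω 0 1 = s.toSite := by
      have : (ω 0).2.1 0 = s := hg.2.2
      simp [path, this]
    refine hun.2 ⟨hun.1, ?_, fun w hw hwp => ?_⟩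
    · exact hpath ▸ hg.2.1 s.toSite (by simp [V])
    · replace hwp : path ω w 1 = s.toSite := hwp.trans hpath
      rcases eq_or_ne w 0 with rfl | hw0
      · exact le_rfl
      · have hn : w ∈ nbrs s.toSite := by
          have hstep : Nbr (path ω w 0) (path ω w 1) := nbr_path_succ ω w 0
          rw [path_zero, hwp] at hstep
          exact mem_nbrs.2 hstep.symm
        have h1 : (ω w).1 = false := hg.2.1 w (by simp [V, hw0, hn])
        have h2 : (ω w).1 = true := hw
        simp [h1] at h2
  have hinc : patternEvent {0} V G ⊆ patternEvent {0} ∅ Set.univ := fun ω hω =>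
    ⟨hω.1, by simp, trivial⟩
  refine (measureReal_mono hsub).trans ?_
  rw [measureReal_sdiff hinc hgood.1, hgood.2, hcar.2, hG]
  simp only [Finset.card_singleton, pow_one, Finset.card_empty, pow_zero, mul_one, probReal_univ]
  have hle : ((1 : ℝ) / 2) ^ (2 * d) ≤ (1 - p) ^ V.card :=
    (pow_le_pow_of_le_one (by norm_num) (by norm_num) hVcard).trans
      (pow_le_pow_left₀ (by norm_num) (by linarith) _)
  have hi : (0 : ℝ) ≤ (2 * d : ℝ)⁻¹ := by positivity
  have := mul_le_mul_of_nonneg_left (mul_le_mul_of_nonneg_right hle hi) hp0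
  linarith

lemma inv_exp_le_pow (n : ℕ) : Real.exp (-1) ≤ (1 - ((n : ℝ) + 1)⁻¹) ^ n := by
  rcases Nat.eq_zero_or_pos n with rfl | hn
  · simp
  · have hn' : (0 : ℝ) < n := by exact_mod_cast hn
    have h1 := Real.add_one_le_exp ((n : ℝ)⁻¹)
    have h2 : Real.exp (-(n : ℝ)⁻¹) ≤ 1 - ((n : ℝ) + 1)⁻¹ := by
      rw [Real.exp_neg]
      refine (inv_anti₀ (by positivity) h1).trans (le_of_eq ?_)
      field_simp
      ring
    refine le_trans (le_of_eq ?_) (pow_le_pow_left₀ (Real.exp_pos _).le h2 n)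
    rw [← Real.exp_nat_mul]
    congr 1
    field_simp

lemma p₀_le_half (d : ℕ) : p₀ d ≤ 1 / 2 := by
  unfold p₀
  split_ifs
  · exact le_rfl
  · have := Real.sqrt_nonneg (1 - (2 * (d : ℝ) * Real.exp 1) ^ (-2 : ℤ))
    linarith

/-- Below the threshold, the weight of explanations is beaten by the weight of animals. -/
lemma exists_percolation_parameter [NeZero d] {b : ℝ} (hb : b < p₀ d) :
    ∃ q : ℝ, 0 < q ∧ q < 1 ∧ 2 * √(b * (1 - b)) < q * (1 - q) ^ (2 * d - 2) := by
  have hd := NeZero.one_le (n := d)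
  have hbh := hb.trans_le (p₀_le_half d)
  rcases hd.eq_or_lt with rfl | hd2
  -- In dimension one the exponent `2d - 2` is `0`, so `q` itself may approach `1`.
  · have h1 : 2 * √(b * (1 - b)) < 1 := by
      have : √(b * (1 - b)) < 1 / 2 := by
        rw [Real.sqrt_lt' (by norm_num)]
        nlinarith [sq_pos_of_pos (sub_pos.2 hbh)]
      linarith
    obtain ⟨q, hq, hq1⟩ := exists_between h1
    exact ⟨q, (by positivity : 0 ≤ 2 * √(b * (1 - b))).trans_lt hq, hq1, by simpa using hq⟩
  · have hD : (2 : ℝ) ≤ d := by exact_mod_cast hd2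
    have he := Real.exp_pos 1
    have hp := hb
    rw [p₀, if_neg (by omega)] at hp
    have h1 : √(1 - (2 * (d : ℝ) * Real.exp 1) ^ (-2 : ℤ)) < 1 - 2 * b := by linarith
    have h2 := Real.lt_sq_of_sqrt_lt h1
    have h3 : 4 * (b * (1 - b)) < ((2 * (d : ℝ) * Real.exp 1)⁻¹) ^ 2 := by
      rw [zpow_neg, show (2 : ℤ) = ((2 : ℕ) : ℤ) from rfl, zpow_natCast, ← inv_pow] at h2
      linarith
    have h4 : 2 * √(b * (1 - b)) < (2 * (d : ℝ) * Real.exp 1)⁻¹ := by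
      have : √(b * (1 - b)) < (2 * (d : ℝ) * Real.exp 1)⁻¹ / 2 := by
        rw [Real.sqrt_lt' (by positivity), div_pow]
        linarith
      linarith
    -- `q = 1/(2d-1)` maximizes `q(1-q)^(2d-2)`, and the value there is at least `1/(2de)`.
    refine ⟨(((2 * d - 2 : ℕ) : ℝ) + 1)⁻¹, by positivity, ?_, h4.trans_le ?_⟩
    · refine inv_lt_one_of_one_lt₀ ?_
      have : (0 : ℝ) < (2 * d - 2 : ℕ) := by exact_mod_cast (by omega)
      linarith
    · have h5 := inv_exp_le_pow (2 * d - 2)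
      have h6 : (2 * (d : ℝ))⁻¹ ≤ (((2 * d - 2 : ℕ) : ℝ) + 1)⁻¹ := by
        refine inv_anti₀ (by positivity) ?_
        rw [Nat.cast_sub (by omega)]
        push_cast
        linarith
      rw [mul_inv, ← Real.exp_neg]
      exact mul_le_mul h6 h5 (Real.exp_pos _).le (by positivity)

/-- The two ways of spending the time `t` in a set of size `m` are balanced at
`m = t ^ (d / (d + 2))`. -/
lemma rpow_le_max [NeZero d] {m t : ℝ} (hm : 0 < m) (ht : 0 < t) :
    t ^ ((d : ℝ) / (d + 2)) ≤ m ∨ t ^ ((d : ℝ) / (d + 2)) ≤ t / m ^ (2 / (d : ℝ)) := by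
  have hd : (0 : ℝ) < d := by exact_mod_cast NeZero.pos d
  rcases le_total (t ^ ((d : ℝ) / (d + 2))) m with h | h
  · exact Or.inl h
  · right
    rw [le_div_iff₀ (by positivity)]
    have h1 := Real.rpow_le_rpow hm.le h (show 0 ≤ 2 / (d : ℝ) by positivity)
    rw [← Real.rpow_mul ht.le] at h1
    calc t ^ ((d : ℝ) / (d + 2)) * m ^ (2 / (d : ℝ)) ≤
          t ^ ((d : ℝ) / (d + 2)) * t ^ ((d : ℝ) / (d + 2) * (2 / d)) := by gcongr
      _ = t := by
        rw [← Real.rpow_add ht]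
        have : (d : ℝ) / (d + 2) + (d : ℝ) / (d + 2) * (2 / d) = 1 := by field_simp
        rw [this, Real.rpow_one]

/-- All constants are computed at `b`; they serve every `p ≤ b` because `p(1-p)` increases on `[0,
1/2]`. -/
lemma exists_prefactor_bound [NeZero d] {b : ℝ} (hb0 : 0 ≤ b) (hb : b < p₀ d) :
    ∃ K c : ℝ, 0 < K ∧ 0 < c ∧ ∀ p : unitInterval, (p : ℝ) ≤ b → ∀ t : ℕ, 1 ≤ t →
      (law d p).real {ω | (t : ℝ≥0∞) < parkingTime 0 ω} ≤
        p * (K * Real.exp (-c * (t : ℝ) ^ ((d : ℝ) / (d + 2)))) := by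
  obtain ⟨q, hq0, hq1, hq⟩ := exists_percolation_parameter hb
  obtain ⟨c, hc, hsurv⟩ := exists_survival_le d
  have hbh := hb.trans_le (p₀_le_half d)
  have h1q : 0 < 1 - q := by linarith
  set κ := q * (1 - q) ^ (2 * d - 2) with hκ
  have hκ0 : 0 < κ := by positivity
  set s := √(b * (1 - b)) with hs
  have hs0 : 0 ≤ s := Real.sqrt_nonneg _
  -- A strict intermediate value keeps `μ` positive even when `b = 0`, so that its logarithm is
  -- usable.
  obtain ⟨μ, hμ, hμ1⟩ := exists_between ((div_lt_one hκ0).2 hq)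
  have hμ0 : 0 < μ := (by positivity : 0 ≤ 2 * s / κ).trans_lt hμ
  have hsμ : 2 * s ≤ μ * κ := ((div_lt_iff₀ hκ0).1 hμ).le
  have hlog : 0 < -Real.log μ := neg_pos.2 (Real.log_neg hμ0 hμ1)
  set c' := min (-Real.log μ) c with hc'
  have hc'0 : 0 < c' := lt_min hlog hc
  refine ⟨4 / (μ * κ) * ((1 - q) ^ 2)⁻¹, c', by positivity, hc'0, fun p hp t ht => ?_⟩
  have ht0 : (0 : ℝ) < t := by exact_mod_cast ht
  have hps : (p : ℝ) * (1 - p) ≤ s ^ 2 := by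
    rw [hs, Real.sq_sqrt (mul_nonneg hb0 (by linarith))]
    nlinarith [p.2.1]
  set x := (t : ℝ) ^ ((d : ℝ) / (d + 2)) with hx
  have hx0 : 0 < x := by positivity
  have hmain := law_unparked_le (d := d) (E := 4 / (μ * κ) * Real.exp (-c' * x)) (hp.trans hbh.le) hs0 hps
    hq0 hq1 t ?_
  · refine hmain.trans (le_of_eq ?_)
    ring
  intro A hA
  rw [← hκ]
  have hAne : A.Nonempty := ⟨0, hA⟩
  obtain ⟨k, hk⟩ := Nat.exists_eq_succ_of_ne_zero hAne.card_pos.ne'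
  have hm : (0 : ℝ) < A.card := by exact_mod_cast hAne.card_pos
  have hexp : μ ^ A.card * survival (A : Set (Site d)) t 0 ≤ 2 * Real.exp (-c' * x) := by
    have hμe : μ ^ A.card = Real.exp (-(-Real.log μ) * A.card) := by
      rw [neg_neg, mul_comm, Real.exp_nat_mul, Real.exp_log hμ0]
    have hq0' : (0 : ℝ) ≤ t / (A.card : ℝ) ^ (2 / (d : ℝ)) := by positivity
    calc μ ^ A.card * survival (A : Set (Site d)) t 0 ≤
          Real.exp (-(-Real.log μ) * A.card) *
            (2 * Real.exp (-c * (t / (A.card : ℝ) ^ (2 / (d : ℝ))))) := by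
          rw [hμe]
          exact mul_le_mul_of_nonneg_left (hsurv A t 0 hAne) (Real.exp_pos _).le
      _ = 2 * Real.exp (-(-Real.log μ) * A.card +
            -c * (t / (A.card : ℝ) ^ (2 / (d : ℝ)))) := by rw [Real.exp_add]; ring
      _ ≤ _ := by
          refine mul_le_mul_of_nonneg_left (Real.exp_le_exp.2 ?_) (by norm_num)
          have hc1 : c' ≤ -Real.log μ := min_le_left _ _
          have hc2 : c' ≤ c := min_le_right _ _
          rcases rpow_le_max (d := d) hm ht0 with h | h
          · have h1 := mul_le_mul hc1 h hx0.le hlog.le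
            have h2 := mul_nonneg hc.le hq0'
            linarith
          · have h1 := mul_le_mul hc2 h hx0.le hc.le
            have h2 := mul_nonneg hlog.le hm.le
            linarith
  have hpow : 2 ^ A.card * s ^ (A.card - 1) ≤ 2 / (μ * κ) * (κ ^ A.card * μ ^ A.card) := by
    rw [hk, Nat.succ_sub_one, Nat.succ_eq_add_one]
    calc (2 : ℝ) ^ (k + 1) * s ^ k = 2 * (2 * s) ^ k := by rw [mul_pow]; ring
      _ ≤ 2 * (μ * κ) ^ k := by gcongr
      _ = _ := by rw [mul_pow]; field_simp; ring
  calc 2 ^ A.card * s ^ (A.card - 1) * survival (A : Set (Site d)) t 0 ≤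
        2 / (μ * κ) * (κ ^ A.card * μ ^ A.card) * survival (A : Set (Site d)) t 0 :=
        mul_le_mul_of_nonneg_right hpow (survival_nonneg _ _ _)
    _ = 2 / (μ * κ) * κ ^ A.card * (μ ^ A.card * survival (A : Set (Site d)) t 0) := by ring
    _ ≤ 2 / (μ * κ) * κ ^ A.card * (2 * Real.exp (-c' * x)) :=
        mul_le_mul_of_nonneg_left hexp (by positivity)
    _ = _ := by ring

/-- The stretched exponential upper bound, uniformly below a subcritical density. -/
lemma exists_uniform_upper_bound [NeZero d] {b : ℝ} (hb0 : 0 ≤ b) (hb : b < p₀ d) :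
    ∃ c : ℝ, 0 < c ∧ ∀ p : unitInterval, (p : ℝ) ≤ b → ∀ t : ℕ, 1 ≤ t →
      (law d p).real {ω | (t : ℝ≥0∞) < parkingTime 0 ω} ≤
        p * Real.exp (-c * (t : ℝ) ^ ((d : ℝ) / (d + 2))) := by
  obtain ⟨K, c, hK, hc, hbound⟩ := exists_prefactor_bound hb0 hb
  have hd : (1 : ℝ) ≤ d := by exact_mod_cast NeZero.one_le (n := d)
  set δ : ℝ := (1 / 2) ^ (2 * d) * (2 * d : ℝ)⁻¹ with hδ
  have hδ0 : 0 < δ := by positivity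
  have hδ1 : δ < 1 := by
    have h1 : ((1 : ℝ) / 2) ^ (2 * d) ≤ 1 := pow_le_one₀ (by norm_num) (by norm_num)
    have h2 : (2 * d : ℝ)⁻¹ < 1 := inv_lt_one_of_one_lt₀ (by linarith)
    calc δ ≤ 1 * (2 * d : ℝ)⁻¹ := by rw [hδ]; gcongr
      _ < 1 := by linarith
  have hD : 0 < -Real.log (1 - δ) := neg_pos.2 (Real.log_neg (by linarith) (by linarith))
  -- Beyond `X`, half of the exponent absorbs `K`; below `X`, the first-step factor `1 - δ`
  -- suffices.
  set X := max 1 (2 * Real.log K / c) with hX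
  have hX1 : 1 ≤ X := le_max_left _ _
  refine ⟨min (c / 2) (-Real.log (1 - δ) / X), lt_min (by positivity) (by positivity),
    fun p hp t ht => ?_⟩
  set x := (t : ℝ) ^ ((d : ℝ) / (d + 2)) with hx
  have hx0 : 0 ≤ x := by positivity
  have hp0 : (0 : ℝ) ≤ p := p.2.1
  rcases le_total X x with h | h
  · refine (hbound p hp t ht).trans (mul_le_mul_of_nonneg_left ?_ hp0)
    rw [← hx, ← Real.exp_log hK, ← Real.exp_add, Real.exp_le_exp]
    have h1 : 2 * Real.log K / c ≤ x := (le_max_right _ _).trans h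
    rw [div_le_iff₀ hc] at h1
    have h2 := mul_le_mul_of_nonneg_right (min_le_left (c / 2) (-Real.log (1 - δ) / X)) hx0
    linarith
  · refine (law_unparked_one_le (hp.trans (hb.trans_le (p₀_le_half d)).le) ht).trans
      (mul_le_mul_of_nonneg_left ?_ hp0)
    rw [← hδ]
    refine (Real.exp_log (show 0 < 1 - δ by linarith)).symm.le.trans (Real.exp_le_exp.2 ?_)
    have h1 := mul_le_mul (min_le_right (c / 2) (-Real.log (1 - δ) / X)) h hx0 (by positivity)
    rw [div_mul_cancel₀ _ (by linarith)] at h1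
    linarith

end Parking

end

theorem theorem1p1 (d : ℕ) [NeZero d] :
    (∀ p : unitInterval, 0 < p →
      ∃ C₁ : ℝ, 0 < C₁ ∧ ∀ t : ℕ, 1 ≤ t →
        Real.exp (-C₁ * (t : ℝ) ^ ((d : ℝ) / ((d : ℝ) + 2))) ≤
          (Parking.law d p).real {ω | (t : ENNReal) < Parking.parkingTime 0 ω}) ∧
    (∃ c₂ : unitInterval → ℝ,
      (∀ p : unitInterval, (p : ℝ) < Parking.p₀ d →
        0 < c₂ p ∧ ∀ t : ℕ, 1 ≤ t →
          (Parking.law d p).real {ω | (t : ENNReal) < Parking.parkingTime 0 ω} ≤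
            (p : ℝ) * Real.exp (-c₂ p * (t : ℝ) ^ ((d : ℝ) / ((d : ℝ) + 2)))) ∧
      (∀ a b : ℝ, Set.Icc a b ⊆ Set.Ico 0 (Parking.p₀ d) →
        ∃ c : ℝ, 0 < c ∧ ∀ p : unitInterval, (p : ℝ) ∈ Set.Icc a b → c ≤ c₂ p)) := by
  refine ⟨Parking.exists_lower_bound d, ?_⟩
  -- Admissible constants, capped at `1` to keep the supremum finite: at `p = 0` every constant
  -- would qualify.
  let S : unitInterval → Set ℝ := fun p => {c | c ≤ 1 ∧ ∀ t : ℕ, 1 ≤ t →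
    (Parking.law d p).real {ω | (t : ENNReal) < Parking.parkingTime 0 ω} ≤
      (p : ℝ) * Real.exp (-c * (t : ℝ) ^ ((d : ℝ) / ((d : ℝ) + 2)))}
  have hbdd : ∀ p, BddAbove (S p) := fun p => ⟨1, fun c hc => hc.1⟩
  have hmem : ∀ b : ℝ, 0 ≤ b → b < Parking.p₀ d →
      ∃ c : ℝ, 0 < c ∧ ∀ p : unitInterval, (p : ℝ) ≤ b → c ∈ S p := by
    intro b hb0 hb
    obtain ⟨c, hc, h⟩ := Parking.exists_uniform_upper_bound hb0 hb
    refine ⟨min c 1, lt_min hc one_pos, fun p hp => ⟨min_le_right _ _, fun t ht =>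
      (h p hp t ht).trans (mul_le_mul_of_nonneg_left (Real.exp_le_exp.2 ?_) p.2.1)⟩⟩
    exact mul_le_mul_of_nonneg_right (neg_le_neg (min_le_left _ _)) (by positivity)
  -- Half of the supremum lies strictly below some admissible constant, and it inherits half of any
  -- constant admissible for all `p ≤ b`.
  refine ⟨fun p => sSup (S p) / 2, fun p hp => ?_, fun a b hab => ?_⟩
  · obtain ⟨c, hc, h⟩ := hmem p p.2.1 hp
    have hle : c ≤ sSup (S p) := le_csSup (hbdd p) (h p le_rfl)
    refine ⟨by linarith, fun t ht => ?_⟩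
    obtain ⟨c', hc', hlt⟩ := exists_lt_of_lt_csSup ⟨c, h p le_rfl⟩
      (show sSup (S p) / 2 < sSup (S p) by linarith)
    refine (hc'.2 t ht).trans (mul_le_mul_of_nonneg_left (Real.exp_le_exp.2 ?_) p.2.1)
    exact mul_le_mul_of_nonneg_right (neg_le_neg hlt.le) (by positivity)
  · rcases lt_or_ge b a with h | h
    · exact ⟨1, one_pos, fun p hp => absurd (hp.1.trans hp.2) (not_le.2 h)⟩
    · obtain ⟨hb0, hb⟩ := hab (Set.right_mem_Icc.2 h)
      obtain ⟨c, hc, hcS⟩ := hmem b hb0 hb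
      refine ⟨c / 2, by positivity, fun p hp => ?_⟩
      have := le_csSup (hbdd p) (hcS p hp.2)
      simp only
      linarith
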